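/- Let $k$ be a field with $\mathrm{char}(k)\neq 2$, $k^s$ a separable closure of $k$, and $\Gamma=\mathrm{Gal}(k^s/k)$; write $H^1(k,H)=H^1(\Gamma,H(k^s))$ for (non-abelian) continuous Galois cohomology. Let $n\ge 1$ and let $W$ be a non-degenerate split orthogonal space over $k$ of dimension $2n+1$ (i.e. having a totally isotropic subspace of dimension $n$) and determinant $(-1)^n$ in $k^*/k^{*2}$, with symmetric bilinear form $\langle\,,\rangle$. Let $\mathrm{SO}(W)$ act by conjugation on $\mathrm{End}(W)$, and for an operator $T$ on $W$ let $G_T\subset \mathrm{SO}(W)$ be its stabilizer. If $T$ and $S=gTg^{-1}$ are defined over $k$, with $g\in\mathrm{SO}(W)(k^s)$, the class of $S$ in $H^1(k,G_T)$ is the class of the cocycle $\sigma\mapsto g^{-1}\sigma(g)$. (1) Let $f(x)=xg(x^2)$ be monic and separable of degree $2n+1$ over $k$. Put $L=k[x]/(f(x))$, $K=k[x]/(g(x))$, $E=k[x]/(g(x^2))$, where $E$ is a $K$-algebra through $x\mapsto x^2$, let $N:E^*\to K^*$ be the norm, and let $\tau$ be the involution $x\mapsto -x$ of $E$ and $L$.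 Call an operator on $W$ distinguished if it corresponds to multiplication by $x$ under some $k$-linear isometry $L\cong W$, where $L$ carries the form $\langle\lambda,\mu\rangle=$ the coefficient of $x^{2n}$ in $(-1)^n\lambda\mu^\tau$. Then the distinguished operators form a single $\mathrm{SO}(W)(k)$-orbit of skew self-adjoint operators on $W$ with characteristic polynomial $f$. Let $T$ be a distinguished operator. All skew self-adjoint operators on $W$ with characteristic polynomial $f$ lie in the $\mathrm{SO}(W)(k^s)$-orbit of $T$, and the $\mathrm{SO}(W)(k)$-orbits of such operators other than that of $T$ correspond bijectively to the non-identity classes $c$ in the kernel (the preimage of the base point) of $$\gamma: K^*/NE^*\xrightarrow{\ \delta\ }H^1(k,G_T)\longrightarrow H^1(k,\mathrm{SO}(W)),$$ in such a way that every operator in the orbit corresponding to $c$ has class $\delta(c)$ in $H^1(k,G_T)$. Here $L\otimes k^s$ is identified with $k^s[T]\subset \mathrm{End}(W\otimes k^s)$, and $\delta$ sends the class of $\kappa\in K^*$ to the class of $\sigma\mapsto h^{-1}\sigma(h)$, where $h\in(L\otimes k^s)^*$ satisfies $h^{1+\tau}=(\kappa,1)\in K^*\times k^*\subset (E\oplus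 k)^*=L^*$. The second map is induced by the inclusion $G_T\subset\mathrm{SO}(W)$. (2) Let $f(x)$ be monic and separable of degree $2n+1$ over $k$, and put $L=k[x]/(f(x))$. Call an operator on $W$ distinguished if it corresponds to multiplication by $x$ under some $k$-linear isometry $L\cong W$, where $L$ carries the form $\langle\lambda,\mu\rangle=$ the coefficient of $x^{2n}$ in $\lambda\mu$. Then the distinguished operators form a single $\mathrm{SO}(W)(k)$-orbit of self-adjoint operators on $W$ with characteristic polynomial $f$. Let $T$ be a distinguished operator. All self-adjoint operators on $W$ with characteristic polynomial $f$ lie in the $\mathrm{SO}(W)(k^s)$-orbit of $T$, and the $\mathrm{SO}(W)(k)$-orbits of such operators other than that of $T$ correspond bijectively to the non-identity classes $c$ in the kernel of $$\gamma:(L^*/L^{*2})_{N=1}\xrightarrow{\ \delta\ }H^1(k,G_T)\longrightarrow H^1(k,\mathrm{SO}(W)),$$ in such a way that every operator in the orbit corresponding to $c$ has class $\delta(c)$ in $H^1(k,G_T)$. Here $(L^*/L^{*2})_{N=1}$ is the kernel of the norm $L^*/L^{*2}\to k^*/k^{*2}$, and $\delta$ sends the class of $\alpha\in L^*$ to the class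 of $\sigma\mapsto h^{-1}\sigma(h)$, where $h\in (L\otimes k^s)^*=k^s[T]^*$ satisfies $h^2=\alpha$. -/

import Mathlib

open Polynomial TensorProduct

noncomputable section

namespace ArithInv

/-! ## Nonabelian first cohomology of a topological group with discrete coefficients -/

section Cohomology

/-- Continuous 1-cocycles on `Γ` with values in the discrete `Γ`-group `A`. -/
structure Cocycle (Γ A : Type*) [Group Γ] [TopologicalSpace Γ] [Group A]
    [MulDistribMulAction Γ A] where
  toFun : Γ → A
  cocycle : ∀ σ τ, toFun (σ * τ) = toFun σ * σ • toFun τ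
  continuous : IsLocallyConstant toFun

/-- `a` and `b` are cohomologous if `b σ = c⁻¹ * a σ * σ(c)` for some `c`. -/
def cohomologous (Γ A : Type*) [Group Γ] [TopologicalSpace Γ] [Group A]
    [MulDistribMulAction Γ A] : Setoid (Cocycle Γ A) where
  r a b := ∃ c : A, ∀ σ, b.toFun σ = c⁻¹ * a.toFun σ * σ • c
  iseqv :=
    { refl := fun a => ⟨1, by simp⟩
      symm := by
        rintro a b ⟨c, hc⟩
        refine ⟨c⁻¹, fun σ => ?_⟩
        rw [hc σ, smul_inv']
        group
      trans := by
        rintro a b d ⟨c, hc⟩ ⟨e, he⟩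
        refine ⟨c * e, fun σ => ?_⟩
        rw [he σ, hc σ, smul_mul']
        group }

/-- The pointed set `H¹(Γ, A)`. -/
def H1 (Γ A : Type*) [Group Γ] [TopologicalSpace Γ] [Group A]
    [MulDistribMulAction Γ A] : Type _ :=
  Quotient (cohomologous Γ A)

variable {Γ A A' : Type*} [Group Γ] [TopologicalSpace Γ] [Group A] [MulDistribMulAction Γ A]
  [Group A'] [MulDistribMulAction Γ A']

/-- The class of a cocycle. -/
def H1.mk (a : Cocycle Γ A) : H1 Γ A := Quotient.mk (cohomologous Γ A) a

/-- The base point of `H¹(Γ, A)`: the class of the constant cocycle `1`. -/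
def H1.base (Γ A : Type*) [Group Γ] [TopologicalSpace Γ] [Group A]
    [MulDistribMulAction Γ A] : H1 Γ A :=
  H1.mk ⟨fun _ => 1, by simp, IsLocallyConstant.const 1⟩

/-- The map `H¹(Γ, A) → H¹(Γ, A')` induced by a `Γ`-equivariant homomorphism `A → A'`. -/
def H1.map (φ : A →* A') (hφ : ∀ (σ : Γ) a, φ (σ • a) = σ • φ a) : H1 Γ A → H1 Γ A' :=
  Quotient.map' (s₁ := cohomologous Γ A) (s₂ := cohomologous Γ A')
    (fun a => ⟨fun σ => φ (a.toFun σ), fun σ τ => by rw [a.cocycle, map_mul, hφ],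
      a.continuous.comp φ⟩)
    (by
      rintro a b ⟨c, hc⟩
      exact ⟨φ c, fun σ => by simp [hc σ, hφ]⟩)

end Cohomology

/-! ## The split odd orthogonal space and its special orthogonal group -/

/-- `(W, B)` is a non-degenerate split orthogonal space of dimension `2n+1` (that is, it has a
totally isotropic subspace of dimension `n`) and of determinant `(-1)ⁿ` in `k*/k*²`. -/
structure IsSplitOrthogonal {k W : Type*} [Field k] [AddCommGroup W] [Module k W] (n : ℕ)
    (B : LinearMap.BilinForm k W) : Prop where
  symm : B.IsSymm
  nondegenerate : B.Nondegenerate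
  finrank : Module.finrank k W = 2 * n + 1
  split : ∃ X : Submodule k W, Module.finrank k X = n ∧ ∀ v ∈ X, ∀ w ∈ X, B v w = 0
  det : ∃ (b : Module.Basis (Fin (2 * n + 1)) k W) (c : k), c ≠ 0 ∧
    (LinearMap.BilinForm.toMatrix b B).det = (-1) ^ n * c ^ 2

/-- The special orthogonal group of a bilinear form. -/
def SO {R M : Type*} [Field R] [AddCommGroup M] [Module R M] (B : LinearMap.BilinForm R M) :
    Subgroup (LinearMap.GeneralLinearGroup R M) where
  carrier := {g | (∀ v w, B ((g : Module.End R M) v) ((g : Module.End R M) w) = B v w) ∧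
    LinearMap.det (g : Module.End R M) = 1}
  mul_mem' := by
    rintro g h ⟨hg, hg'⟩ ⟨hh, hh'⟩
    refine ⟨fun v w => ?_, ?_⟩
    · simp only [Units.val_mul, Module.End.mul_apply]
      rw [hg, hh]
    · rw [Units.val_mul, map_mul, hg', hh', one_mul]
  one_mem' := ⟨fun v w => rfl, by simp⟩
  inv_mem' := by
    rintro g ⟨hg, hg'⟩
    have key : ∀ v, (g : Module.End R M) (((g⁻¹ : LinearMap.GeneralLinearGroup R M) : Module.End R M) v) = v := fun v => by
      rw [← Module.End.mul_apply, Units.mul_inv, Module.End.one_apply]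
    refine ⟨fun v w => ?_, ?_⟩
    · rw [← hg, key, key]
    · have := congrArg LinearMap.det (Units.mul_inv g)
      rw [map_mul, hg', one_mul] at this
      simpa using this

/-- The `SO(B)`-orbit of an operator under conjugation. -/
def orbit {R M : Type*} [Field R] [AddCommGroup M] [Module R M] (B : LinearMap.BilinForm R M)
    (T : Module.End R M) : Set (Module.End R M) :=
  {S | ∃ g ∈ SO B, S = (g : Module.End R M) * T * (g⁻¹ : LinearMap.GeneralLinearGroup R M)}

/-! ## Points over the separable closure and the Galois action on them -/

section Galois

variable {k : Type*} (ks : Type*) {W : Type*} [Field k] [Field ks] [Algebra k ks]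
  [AddCommGroup W] [Module k W]

/-- The Galois group acts on `kˢ ⊗ W` through the first factor, semilinearly. -/
theorem smul_semilinear (σ : ks ≃ₐ[k] ks) (c : ks) (x : ks ⊗[k] W) :
    σ • (c • x) = σ c • (σ • x) := by
  induction x with
  | zero => simp
  | tmul a w => simp [TensorProduct.smul_tmul']
  | add x y hx hy => rw [smul_add, smul_add, hx, hy, smul_add, smul_add]

/-- The Galois action on endomorphisms of `kˢ ⊗ W`: `σ` sends `g` to `σ ∘ g ∘ σ⁻¹`. -/
def galEnd (σ : ks ≃ₐ[k] ks) : Module.End ks (ks ⊗[k] W) →+* Module.End ks (ks ⊗[k] W) where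
  toFun g :=
    { toFun := fun x => σ • g (σ⁻¹ • x)
      map_add' := fun x y => by simp
      map_smul' := fun c x => by
        rw [smul_semilinear, map_smul, smul_semilinear, ← AlgEquiv.mul_apply, mul_inv_cancel]
        rfl }
  map_one' := by ext; simp
  map_mul' g h := by
    refine LinearMap.ext fun x => ?_
    simp [Module.End.mul_apply]
  map_zero' := by ext; simp
  map_add' g h := by
    refine LinearMap.ext fun x => ?_
    simp

theorem galEnd_apply (σ : ks ≃ₐ[k] ks) (g : Module.End ks (ks ⊗[k] W)) (x : ks ⊗[k] W) :
    galEnd ks σ g x = σ • g (σ⁻¹ • x) := rfl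

/-- The Galois action on `GL(W)(kˢ)`. -/
def galGL (σ : ks ≃ₐ[k] ks) : LinearMap.GeneralLinearGroup ks (ks ⊗[k] W) →*
    LinearMap.GeneralLinearGroup ks (ks ⊗[k] W) :=
  Units.map (galEnd ks σ).toMonoidHom

instance galoisActionGL : MulDistribMulAction (ks ≃ₐ[k] ks)
    (LinearMap.GeneralLinearGroup ks (ks ⊗[k] W)) where
  smul σ g := galGL ks σ g
  one_smul g := Units.ext (LinearMap.ext fun x => by
    change (1 : ks ≃ₐ[k] ks) • g.val ((1 : ks ≃ₐ[k] ks)⁻¹ • x) = g.val x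
    simp)
  mul_smul σ τ g := Units.ext (LinearMap.ext fun x => by
    change (σ * τ) • g.val ((σ * τ)⁻¹ • x) = σ • (τ • g.val (τ⁻¹ • (σ⁻¹ • x)))
    simp [mul_smul])
  smul_mul σ g h := map_mul (galGL ks σ) g h
  smul_one σ := map_one (galGL ks σ)

theorem coe_smul (σ : ks ≃ₐ[k] ks) (g : LinearMap.GeneralLinearGroup ks (ks ⊗[k] W)) :
    ((σ • g : LinearMap.GeneralLinearGroup ks (ks ⊗[k] W)) : Module.End ks (ks ⊗[k] W)) =
      galEnd ks σ (g : Module.End ks (ks ⊗[k] W)) := rfl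

theorem galEnd_baseChange (σ : ks ≃ₐ[k] ks) (T : Module.End k W) :
    galEnd ks σ (T.baseChange ks) = T.baseChange ks := by
  refine LinearMap.ext fun x => ?_
  rw [galEnd_apply]
  induction x with
  | zero => simp
  | tmul a w =>
    rw [TensorProduct.smul_tmul', LinearMap.baseChange_tmul, LinearMap.baseChange_tmul,
      TensorProduct.smul_tmul', smul_inv_smul]
  | add x y hx hy => rw [smul_add, map_add, smul_add, hx, hy, map_add]

theorem galEnd_algebraMap (σ : ks ≃ₐ[k] ks) (c : ks) :
    galEnd (k := k) (W := W) ks σ (algebraMap ks _ c) = algebraMap ks _ (σ c) := by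
  refine LinearMap.ext fun x => ?_
  rw [galEnd_apply, Module.algebraMap_end_apply, smul_semilinear, smul_inv_smul,
    Module.algebraMap_end_apply]

theorem baseChange_smul_smul (B : LinearMap.BilinForm k W) (σ : ks ≃ₐ[k] ks)
    (x y : ks ⊗[k] W) :
    B.baseChange ks (σ • x) (σ • y) = σ (B.baseChange ks x y) := by
  induction x with
  | zero => simp
  | add x x' hx hx' => rw [smul_add, map_add, map_add, LinearMap.add_apply, LinearMap.add_apply,
      hx, hx', map_add]
  | tmul a w =>
    induction y with
    | zero => simp
    | add y y' hy hy' => rw [smul_add, map_add, map_add, hy, hy', map_add]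
    | tmul b v => simp [TensorProduct.smul_tmul', LinearMap.BilinForm.baseChange_tmul]

/-- `SO(W)(kˢ)`, as a subgroup of `GL(W)(kˢ)`. -/
abbrev SOs (B : LinearMap.BilinForm k W) :
    Subgroup (LinearMap.GeneralLinearGroup ks (ks ⊗[k] W)) :=
  SO (B.baseChange ks)

variable [FiniteDimensional k W]

theorem det_galEnd (σ : ks ≃ₐ[k] ks) (g : Module.End ks (ks ⊗[k] W)) :
    LinearMap.det (galEnd ks σ g) = σ (LinearMap.det g) := by
  classical
  let b := Algebra.TensorProduct.basis ks (Module.finBasis k W)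
  have hb : ∀ (τ : ks ≃ₐ[k] ks) i, τ • b i = b i := fun τ i => by
    simp [b, TensorProduct.smul_tmul']
  have hr : ∀ (x : ks ⊗[k] W) i, b.repr (σ • x) i = σ (b.repr x i) := fun x i => by
    conv_lhs => rw [← b.sum_repr x, Finset.smul_sum]
    simp only [smul_semilinear, hb]
    rw [b.repr_sum_self]
  rw [← LinearMap.det_toMatrix b, ← LinearMap.det_toMatrix b]
  have : LinearMap.toMatrix b b (galEnd ks σ g) =
      (σ : ks →+* ks).mapMatrix (LinearMap.toMatrix b b g) := by
    ext i j
    simp [LinearMap.toMatrix_apply, galEnd_apply, hb, hr]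
  rw [this, ← RingHom.map_det]
  rfl

theorem smul_mem_SOs (B : LinearMap.BilinForm k W) (σ : ks ≃ₐ[k] ks)
    {g : LinearMap.GeneralLinearGroup ks (ks ⊗[k] W)} (hg : g ∈ SOs ks B) :
    σ • g ∈ SOs ks B := by
  refine ⟨fun v w => ?_, ?_⟩
  · rw [coe_smul, galEnd_apply, galEnd_apply, baseChange_smul_smul, hg.1,
      ← baseChange_smul_smul, smul_inv_smul, smul_inv_smul]
  · rw [coe_smul, det_galEnd, hg.2, map_one]

/-- The Galois action on `SO(W)(kˢ)`. -/
instance galoisActionSO (B : LinearMap.BilinForm k W) : MulDistribMulAction (ks ≃ₐ[k] ks) (SOs ks B) where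
  smul σ g := ⟨σ • (g : LinearMap.GeneralLinearGroup ks (ks ⊗[k] W)), smul_mem_SOs ks B σ g.2⟩
  one_smul _ := Subtype.ext (one_smul _ _)
  mul_smul σ τ _ := Subtype.ext (mul_smul σ τ _)
  smul_mul σ _ _ := Subtype.ext (smul_mul' σ _ _)
  smul_one σ := Subtype.ext (smul_one σ)

/-- `G_T(kˢ)`, the stabilizer of the operator `T` in `SO(W)(kˢ)`. -/
def stabilizer (B : LinearMap.BilinForm k W) (T : Module.End k W) :
    Subgroup (LinearMap.GeneralLinearGroup ks (ks ⊗[k] W)) where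
  carrier := {g | g ∈ SOs ks B ∧ Commute (g : Module.End ks (ks ⊗[k] W)) (T.baseChange ks)}
  mul_mem' := by
    rintro g h ⟨hg, hg'⟩ ⟨hh, hh'⟩
    exact ⟨mul_mem hg hh, by rw [Units.val_mul]; exact hg'.mul_left hh'⟩
  one_mem' := ⟨one_mem _, by rw [Units.val_one]; exact Commute.one_left _⟩
  inv_mem' := by
    rintro g ⟨hg, hg'⟩
    exact ⟨inv_mem hg, hg'.units_inv_left⟩

theorem smul_mem_stabilizer (B : LinearMap.BilinForm k W) (T : Module.End k W)
    (σ : ks ≃ₐ[k] ks) {g : LinearMap.GeneralLinearGroup ks (ks ⊗[k] W)}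
    (hg : g ∈ stabilizer ks B T) : σ • g ∈ stabilizer ks B T := by
  refine ⟨smul_mem_SOs ks B σ hg.1, ?_⟩
  have := hg.2.map (galEnd ks σ)
  rwa [galEnd_baseChange, ← coe_smul] at this

/-- The Galois action on `G_T(kˢ)`. -/
instance galoisActionStabilizer (B : LinearMap.BilinForm k W) (T : Module.End k W) :
    MulDistribMulAction (ks ≃ₐ[k] ks) (stabilizer ks B T) where
  smul σ g := ⟨σ • (g : LinearMap.GeneralLinearGroup ks (ks ⊗[k] W)),
    smul_mem_stabilizer ks B T σ g.2⟩
  one_smul _ := Subtype.ext (one_smul _ _)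
  mul_smul σ τ _ := Subtype.ext (mul_smul σ τ _)
  smul_mul σ _ _ := Subtype.ext (smul_mul' σ _ _)
  smul_one σ := Subtype.ext (smul_one σ)

/-- The map `H¹(k, G_T) → H¹(k, SO(W))` induced by the inclusion of the stabilizer. -/
def stabilizerMap (B : LinearMap.BilinForm k W) (T : Module.End k W) :
    H1 (ks ≃ₐ[k] ks) (stabilizer ks B T) → H1 (ks ≃ₐ[k] ks) (SOs ks B) :=
  H1.map (Subgroup.inclusion fun _ hg => hg.1) fun _ _ => rfl

end Galois

/-! ## The connecting map into `H¹(k, G_T)` -/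

section Connecting

variable {k : Type*} (ks : Type*) {W : Type*} [Field k] [Field ks] [Algebra k ks]
  [AddCommGroup W] [Module k W]

theorem baseChange_mem_adjoin {T A : Module.End k W} (hA : A ∈ Algebra.adjoin k {T}) :
    A.baseChange ks ∈ Algebra.adjoin ks {T.baseChange ks} := by
  induction hA using Algebra.adjoin_induction with
  | mem x hx =>
    rw [Set.mem_singleton_iff.1 hx]
    exact Algebra.subset_adjoin rfl
  | algebraMap r =>
    have : (algebraMap k (Module.End k W) r).baseChange ks = algebraMap ks _ (algebraMap k ks r) := by
      refine LinearMap.ext fun x => ?_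
      induction x with
      | zero => simp
      | tmul a w => simp [Algebra.smul_def, TensorProduct.smul_tmul']
      | add x y hx hy => rw [map_add, hx, hy, map_add]
    rw [this]
    exact Subalgebra.algebraMap_mem _ _
  | add x y _ _ hx hy => rw [LinearMap.baseChange_add]; exact add_mem hx hy
  | mul x y _ _ hx hy => rw [LinearMap.baseChange_mul]; exact mul_mem hx hy

theorem galEnd_mem_adjoin {T : Module.End k W} (σ : ks ≃ₐ[k] ks)
    {h : Module.End ks (ks ⊗[k] W)} (hh : h ∈ Algebra.adjoin ks {T.baseChange ks}) :
    galEnd ks σ h ∈ Algebra.adjoin ks {T.baseChange ks} := by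
  induction hh using Algebra.adjoin_induction with
  | mem x hx =>
    rw [Set.mem_singleton_iff.1 hx, galEnd_baseChange]
    exact Algebra.subset_adjoin rfl
  | algebraMap r => rw [galEnd_algebraMap]; exact Subalgebra.algebraMap_mem _ _
  | add x y _ _ hx hy => rw [map_add]; exact add_mem hx hy
  | mul x y _ _ hx hy => rw [map_mul]; exact mul_mem hx hy

theorem commute_of_mem_adjoin {R : Type*} {M : Type*} [CommSemiring R] [Semiring M] [Algebra R M]
    {t x y : M} (hx : x ∈ Algebra.adjoin R {t}) (hy : y ∈ Algebra.adjoin R {t}) :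
    Commute x y := by
  rw [Algebra.adjoin_singleton_eq_range_aeval] at hx hy
  obtain ⟨p, rfl⟩ := hx
  obtain ⟨q, rfl⟩ := hy
  exact Commute.map (Commute.all p q) (aeval t)

theorem exists_open_fixing [Algebra.IsAlgebraic k ks] {T : Module.End k W}
    {h : Module.End ks (ks ⊗[k] W)} (hh : h ∈ Algebra.adjoin ks {T.baseChange ks}) :
    ∃ U : Subgroup (ks ≃ₐ[k] ks), IsOpen (U : Set (ks ≃ₐ[k] ks)) ∧
      ∀ σ ∈ U, galEnd ks σ h = h := by
  induction hh using Algebra.adjoin_induction with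
  | mem x hx =>
    rw [Set.mem_singleton_iff.1 hx]
    exact ⟨⊤, isOpen_univ, fun σ _ => galEnd_baseChange ks σ T⟩
  | algebraMap r =>
    have : FiniteDimensional k (IntermediateField.adjoin k {r}) :=
      IntermediateField.adjoin.finiteDimensional (Algebra.IsAlgebraic.isAlgebraic r).isIntegral
    refine ⟨(IntermediateField.adjoin k {r}).fixingSubgroup,
      IntermediateField.fixingSubgroup_isOpen _, fun σ hσ => ?_⟩
    rw [galEnd_algebraMap]
    congr 1
    exact hσ ⟨r, IntermediateField.mem_adjoin_simple_self k r⟩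
  | add x y _ _ hx hy =>
    obtain ⟨U, hU, hU'⟩ := hx
    obtain ⟨V, hV, hV'⟩ := hy
    exact ⟨U ⊓ V, hU.inter hV, fun σ hσ => by rw [map_add, hU' σ hσ.1, hV' σ hσ.2]⟩
  | mul x y _ _ hx hy =>
    obtain ⟨U, hU, hU'⟩ := hx
    obtain ⟨V, hV, hV'⟩ := hy
    exact ⟨U ⊓ V, hU.inter hV, fun σ hσ => by rw [map_mul, hU' σ hσ.1, hV' σ hσ.2]⟩

/-- Square roots of elements of a split étale algebra `F[T]`. -/
theorem exists_sqrt {F M : Type*} [Field F] [IsSepClosed F] (h2 : (2 : F) ≠ 0) [Semiring M]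
    [Algebra F M] {t a : M} (f : F[X]) (hf : f.Separable) (hft : aeval t f = 0)
    (ha : a ∈ Algebra.adjoin F {t}) : ∃ h ∈ Algebra.adjoin F {a}, h * h = a := by
  classical
  rw [Algebra.adjoin_singleton_eq_range_aeval] at ha
  obtain ⟨p, rfl⟩ := ha
  have hsq : ∀ x : F, ∃ z, z ^ 2 = x := fun x => by
    have : NeZero ((2 : ℕ) : F) := ⟨by exact_mod_cast h2⟩
    exact IsSepClosed.exists_pow_nat_eq x 2
  choose s hs using hsq
  have hspl : f.Splits := IsSepClosed.splits_of_separable f hf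
  let V : Finset F := f.roots.toFinset.image fun r => p.eval r
  let M' : F[X] := ∏ v ∈ V, (X - C v)
  have hdvd : f ∣ M'.comp p := by
    have h0 : f ≠ 0 := hf.ne_zero
    by_cases hM : M'.comp p = 0
    · rw [hM]; exact dvd_zero _
    refine (Polynomial.Splits.dvd_iff_roots_le_roots hspl h0 hM).2 ?_
    rw [Multiset.le_iff_subset (nodup_roots hf)]
    intro r hr
    rw [mem_roots hM, IsRoot.def, eval_comp]
    simp only [M', eval_prod, eval_sub, eval_X, eval_C]
    exact Finset.prod_eq_zero (Finset.mem_image_of_mem _ (Multiset.mem_toFinset.2 hr)) (sub_self _)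
  have hMt : aeval (aeval t p) M' = 0 := by
    rw [← aeval_comp]
    obtain ⟨c, hc⟩ := hdvd
    rw [hc, map_mul, hft, zero_mul]
  let q : F[X] := Lagrange.interpolate V id s
  have hq : M' ∣ q * q - X := by
    refine Finset.prod_dvd_of_coprime (fun a _ b _ hab => isCoprime_X_sub_C_of_isUnit_sub
      (sub_ne_zero.2 hab).isUnit) fun v hv => ?_
    rw [dvd_iff_isRoot, IsRoot.def, eval_sub, eval_mul, eval_X]
    have := Lagrange.eval_interpolate_at_node (v := id) s (Set.injOn_id _) hv
    rw [id] at this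
    rw [this, ← sq, hs, sub_self]
  refine ⟨aeval (aeval t p) q, ?_, ?_⟩
  · rw [Algebra.adjoin_singleton_eq_range_aeval]
    exact ⟨q, rfl⟩
  · obtain ⟨c, hc⟩ := hq
    have := congrArg (aeval (aeval t p)) (sub_eq_iff_eq_add.1 hc)
    rwa [map_add, map_mul, map_mul, hMt, zero_mul, aeval_X, zero_add] at this

/-- The standing assumptions on `(B, T)`. -/
structure IsRegular (B : LinearMap.BilinForm k W) [FiniteDimensional k W] (T : Module.End k W) :
    Prop where
  two_ne_zero : (2 : k) ≠ 0
  symm : B.IsSymm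
  nondegenerate : B.Nondegenerate
  odd : Odd (Module.finrank k W)
  separable : T.charpoly.Separable

/-- The operators `A = α(T)`, `α ∈ L* = k[T]*`, with `A` self-adjoint and of square norm. -/
structure IsKummerDatum (B : LinearMap.BilinForm k W) (T A : Module.End k W) : Prop where
  mem : A ∈ Algebra.adjoin k {T}
  isUnit : IsUnit A
  selfAdjoint : ∀ v w, B (A v) w = B v (A w)
  det : ∃ c : k, LinearMap.det A = c ^ 2

/-- `h ∈ (L ⊗ kˢ)* = kˢ[T]*` satisfies `h* h = A`, where `h*` is the adjoint of `h`. -/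
def IsKummerElement (B : LinearMap.BilinForm k W) (T A : Module.End k W)
    (h : LinearMap.GeneralLinearGroup ks (ks ⊗[k] W)) : Prop :=
  (h : Module.End ks (ks ⊗[k] W)) ∈ Algebra.adjoin ks {T.baseChange ks} ∧
    ∀ v w, B.baseChange ks ((h : Module.End ks (ks ⊗[k] W)) v)
      ((h : Module.End ks (ks ⊗[k] W)) w) = B.baseChange ks (A.baseChange ks v) w

variable {ks} {B : LinearMap.BilinForm k W} {T A A' : Module.End k W}

theorem baseChange_selfAdjoint (hA : ∀ v w, B (A v) w = B v (A w)) (x y : ks ⊗[k] W) :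
    B.baseChange ks (A.baseChange ks x) y = B.baseChange ks x (A.baseChange ks y) := by
  induction x with
  | zero => simp
  | add x x' hx hx' => simp only [map_add, LinearMap.add_apply, hx, hx']
  | tmul a w =>
    induction y with
    | zero => simp
    | add y y' hy hy' => rw [map_add, map_add, map_add, hy, hy']
    | tmul b v => simp [LinearMap.BilinForm.baseChange_tmul, hA]

theorem adjoin_selfAdjoint {R M : Type*} [Field R] [AddCommGroup M] [Module R M]
    {B : LinearMap.BilinForm R M} {A : Module.End R M} (hA : ∀ v w, B (A v) w = B v (A w))
    {h : Module.End R M} (hh : h ∈ Algebra.adjoin R {A}) : ∀ v w, B (h v) w = B v (h w) := by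
  induction hh using Algebra.adjoin_induction with
  | mem x hx => rwa [Set.mem_singleton_iff.1 hx]
  | algebraMap r => intro v w; simp [Module.algebraMap_end_apply]
  | add x y _ _ hx hy => intro v w; simp [hx, hy]
  | mul x y hx' hy' hx hy =>
    intro v w
    have : x (y w) = y (x w) := by
      rw [← Module.End.mul_apply, (commute_of_mem_adjoin hx' hy').eq, Module.End.mul_apply]
    rw [Module.End.mul_apply, Module.End.mul_apply, hx, hy, this]

theorem baseChange_isUnit (hA : IsUnit A) : IsUnit (A.baseChange ks) := by
  have := hA.map (Module.End.baseChangeHom k ks W)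
  exact this

theorem isometry_of_twisted {a c : Module.End ks (ks ⊗[k] W)} (ha : IsUnit a) (hac : Commute c a)
    (H : ∀ v w, B.baseChange ks (a (c v)) (c w) = B.baseChange ks (a v) w) (v w : ks ⊗[k] W) :
    B.baseChange ks (c v) (c w) = B.baseChange ks v w := by
  obtain ⟨u, rfl⟩ := ha
  obtain ⟨x, rfl⟩ : ∃ x, u.val x = v :=
    ⟨u.inv v, by rw [← Module.End.mul_apply, Units.val_inv, Module.End.one_apply]⟩
  rw [← Module.End.mul_apply, hac.eq, Module.End.mul_apply, H]

theorem mul_inv_apply' {R M : Type*} [Field R] [AddCommGroup M] [Module R M]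
    (h : LinearMap.GeneralLinearGroup R M) (v : M) :
    (h : Module.End R M) (((h⁻¹ : LinearMap.GeneralLinearGroup R M) : Module.End R M) v) = v := by
  rw [← Module.End.mul_apply, Units.mul_inv, Module.End.one_apply]

variable [FiniteDimensional k W]

theorem exists_kummerElement [IsSepClosure k ks] (hB : IsRegular B T) (hA : IsKummerDatum B T A) :
    ∃ h, IsKummerElement ks B T A h := by
  have : IsSepClosed ks := IsSepClosure.sep_closed k
  have hAs := baseChange_selfAdjoint (ks := ks) hA.selfAdjoint
  have h2 : (2 : ks) ≠ 0 := by
    intro h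
    apply hB.two_ne_zero
    apply (algebraMap k ks).injective
    rw [map_ofNat, map_zero, h]
  obtain ⟨h, hh, hh2⟩ := exists_sqrt h2 (t := T.baseChange ks) (a := A.baseChange ks)
    (T.baseChange ks).charpoly (by rw [LinearMap.charpoly_baseChange]; exact hB.separable.map)
    (LinearMap.aeval_self_charpoly _) (baseChange_mem_adjoin ks hA.mem)
  have hu : IsUnit h := by
    have h3 : IsUnit (h * h) := by rw [hh2]; exact baseChange_isUnit hA.isUnit
    exact ((Commute.refl h).isUnit_mul_iff.1 h3).1
  refine ⟨hu.unit, ?_, fun v w => ?_⟩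
  · rw [IsUnit.unit_spec]
    refine Algebra.adjoin_le ?_ hh
    rw [Set.singleton_subset_iff]
    exact baseChange_mem_adjoin ks hA.mem
  · rw [IsUnit.unit_spec, ← adjoin_selfAdjoint hAs hh, ← Module.End.mul_apply, hh2]

theorem det_sq_of_isometry (hB : B.Nondegenerate) {h a : Module.End ks (ks ⊗[k] W)}
    (H : ∀ v w, B.baseChange ks (h v) (h w) = B.baseChange ks (a v) w) :
    LinearMap.det h ^ 2 = LinearMap.det a := by
  classical
  let b₀ := Module.finBasis k W
  let b := Algebra.TensorProduct.basis ks b₀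
  let G := LinearMap.BilinForm.toMatrix b (B.baseChange ks)
  have hG : G = (LinearMap.BilinForm.toMatrix b₀ B).map (algebraMap k ks) := by
    ext i j
    simp [G, b, LinearMap.BilinForm.toMatrix_apply, LinearMap.BilinForm.baseChange_tmul,
      Algebra.algebraMap_eq_smul_one]
  have hdet : G.det ≠ 0 := by
    rw [hG, ← RingHom.mapMatrix_apply, ← RingHom.map_det]
    exact (_root_.map_ne_zero _).2 ((LinearMap.BilinForm.nondegenerate_iff_det_ne_zero b₀).1 hB)
  have e1 : (LinearMap.toMatrix b b h).transpose * G * LinearMap.toMatrix b b h =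
      (LinearMap.toMatrix b b a).transpose * G := by
    have h1 := LinearMap.BilinForm.toMatrix_comp b b (B.baseChange ks) h h
    have h2 := LinearMap.BilinForm.toMatrix_compLeft b (B.baseChange ks) a
    rw [← h1, ← h2]
    congr 1
    exact LinearMap.ext fun v => LinearMap.ext fun w => H v w
  have e2 := congrArg Matrix.det e1
  simp only [Matrix.det_mul, Matrix.det_transpose, LinearMap.det_toMatrix] at e2
  refine mul_right_cancel₀ hdet ?_
  rw [← e2]
  ring

theorem kummer_mem_stabilizer (hB : IsRegular B T) (hA : IsKummerDatum B T A)
    {h : LinearMap.GeneralLinearGroup ks (ks ⊗[k] W)} (hh : IsKummerElement ks B T A h)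
    (σ : ks ≃ₐ[k] ks) : h⁻¹ * σ • h ∈ stabilizer ks B T := by
  have hσ : ((σ • h : LinearMap.GeneralLinearGroup ks (ks ⊗[k] W)) : Module.End ks (ks ⊗[k] W)) ∈
    Algebra.adjoin ks {T.baseChange ks} := galEnd_mem_adjoin ks σ hh.1
  have hcomm : ∀ x ∈ Algebra.adjoin ks {T.baseChange ks},
      Commute ((h⁻¹ * σ • h : LinearMap.GeneralLinearGroup ks (ks ⊗[k] W)) :
        Module.End ks (ks ⊗[k] W)) x := fun x hx => by
    rw [Units.val_mul]
    exact ((commute_of_mem_adjoin hh.1 hx).units_inv_left).mul_left (commute_of_mem_adjoin hσ hx)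
  have hAm := baseChange_mem_adjoin ks hA.mem
  refine ⟨⟨isometry_of_twisted (baseChange_isUnit hA.isUnit) (hcomm _ hAm) fun v w => ?_, ?_⟩,
    hcomm _ (Algebra.subset_adjoin rfl)⟩
  · rw [← hh.2, Units.val_mul, Module.End.mul_apply, Module.End.mul_apply, mul_inv_apply',
      mul_inv_apply', coe_smul, galEnd_apply, galEnd_apply, baseChange_smul_smul, hh.2,
      ← baseChange_smul_smul, ← galEnd_apply, galEnd_baseChange, smul_inv_smul]
  · obtain ⟨c, hc⟩ := hA.det
    have h1 := det_sq_of_isometry hB.nondegenerate hh.2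
    rw [LinearMap.det_baseChange, hc, map_pow, sq_eq_sq_iff_eq_or_eq_neg] at h1
    have h2 : σ (LinearMap.det (h : Module.End ks (ks ⊗[k] W))) =
        LinearMap.det (h : Module.End ks (ks ⊗[k] W)) := by
      rcases h1 with h1 | h1 <;> rw [h1] <;> simp
    rw [Units.val_mul, map_mul, coe_smul, det_galEnd, h2, ← map_mul, Units.inv_mul, map_one]

/-- The cocycle `σ ↦ h⁻¹ σ(h)` with values in `G_T(kˢ)`, where `h* h = A`. -/
def kummerCocycle [Algebra.IsAlgebraic k ks] (hB : IsRegular B T) (hA : IsKummerDatum B T A)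
    (h : LinearMap.GeneralLinearGroup ks (ks ⊗[k] W)) (hh : IsKummerElement ks B T A h) :
    Cocycle (ks ≃ₐ[k] ks) (stabilizer ks B T) where
  toFun σ := ⟨h⁻¹ * σ • h, kummer_mem_stabilizer hB hA hh σ⟩
  cocycle σ τ := by
    apply Subtype.ext
    change h⁻¹ * (σ * τ) • h = (h⁻¹ * σ • h) * σ • (h⁻¹ * τ • h)
    rw [smul_mul', smul_inv', mul_smul]
    group
  continuous := by
    rw [IsLocallyConstant.iff_exists_open]
    intro σ
    obtain ⟨U, hU, hU'⟩ := exists_open_fixing ks hh.1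
    refine ⟨(fun τ => σ⁻¹ * τ) ⁻¹' U, hU.preimage (continuous_const_mul _), ?_, fun τ hτ => ?_⟩
    · simp [U.one_mem]
    · have h1 : (σ⁻¹ * τ) • h = h := Units.ext (hU' _ hτ)
      have h2 : τ • h = σ • h := by
        conv_rhs => rw [← h1, ← mul_smul, mul_inv_cancel_left]
      apply Subtype.ext
      change h⁻¹ * τ • h = h⁻¹ * σ • h
      rw [h2]

/-- If `A' = λ* A λ` with `λ ∈ k[T]*`, then `A` and `A'` define the same class. -/
theorem kummerCocycle_eq [Algebra.IsAlgebraic k ks] (hB : IsRegular B T)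
    (hA : IsKummerDatum B T A) (hA' : IsKummerDatum B T A')
    {h h' : LinearMap.GeneralLinearGroup ks (ks ⊗[k] W)} (hh : IsKummerElement ks B T A h)
    (hh' : IsKummerElement ks B T A' h')
    (H : ∃ l ∈ Algebra.adjoin k {T}, IsUnit l ∧ ∀ v w, B (A' v) w = B (A (l v)) (l w)) :
    H1.mk (kummerCocycle hB hA h hh) = H1.mk (kummerCocycle hB hA' h' hh') := by
  obtain ⟨l, hl, hlu, hl'⟩ := H
  have hls : ∀ x y : ks ⊗[k] W, B.baseChange ks (A'.baseChange ks x) y =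
      B.baseChange ks (A.baseChange ks (l.baseChange ks x)) (l.baseChange ks y) := by
    intro x y
    induction x with
    | zero => simp
    | add x x' hx hx' => simp only [map_add, LinearMap.add_apply, hx, hx']
    | tmul a w =>
      induction y with
      | zero => simp
      | add y y' hy hy' => rw [map_add, map_add, map_add, hy, hy']
      | tmul b v => simp [LinearMap.BilinForm.baseChange_tmul, hl']
  obtain ⟨m, hm⟩ : ∃ m : LinearMap.GeneralLinearGroup ks (ks ⊗[k] W),
      (m : Module.End ks (ks ⊗[k] W)) = l.baseChange ks :=
    ⟨(baseChange_isUnit (ks := ks) hlu).unit, rfl⟩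
  have hmm : (m : Module.End ks (ks ⊗[k] W)) ∈ Algebra.adjoin ks {T.baseChange ks} := by
    rw [hm]; exact baseChange_mem_adjoin ks hl
  -- the element of the stabilizer, up to sign
  let e : LinearMap.GeneralLinearGroup ks (ks ⊗[k] W) := h'⁻¹ * h * m
  have hecomm : ∀ x ∈ Algebra.adjoin ks {T.baseChange ks},
      Commute (e : Module.End ks (ks ⊗[k] W)) x := fun x hx => by
    simp only [e, Units.val_mul]
    exact (((commute_of_mem_adjoin hh'.1 hx).units_inv_left).mul_left
      (commute_of_mem_adjoin hh.1 hx)).mul_left (commute_of_mem_adjoin hmm hx)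
  have hiso : ∀ v w, B.baseChange ks ((e : Module.End ks (ks ⊗[k] W)) v)
      ((e : Module.End ks (ks ⊗[k] W)) w) = B.baseChange ks v w := by
    refine isometry_of_twisted (baseChange_isUnit hA'.isUnit)
      (hecomm _ (baseChange_mem_adjoin ks hA'.mem)) fun v w => ?_
    rw [← hh'.2]
    simp only [e, Units.val_mul, Module.End.mul_apply, mul_inv_apply']
    rw [hh.2, hm, ← hls]
  have hdet : LinearMap.det (e : Module.End ks (ks ⊗[k] W)) ^ 2 = 1 := by
    have := det_sq_of_isometry (ks := ks) (a := 1) hB.nondegenerate (fun v w => hiso v w)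
    rwa [map_one] at this
  obtain ⟨s, hs, hse⟩ : ∃ s : LinearMap.GeneralLinearGroup ks (ks ⊗[k] W),
      s ∈ stabilizer ks B T ∧ ∀ σ : ks ≃ₐ[k] ks, ∀ x,
      s * x * (σ • s)⁻¹ = e * x * (σ • e)⁻¹ := by
    rcases (sq_eq_one_iff.1 hdet) with hd | hd
    · exact ⟨e, ⟨⟨hiso, hd⟩, hecomm _ (Algebra.subset_adjoin rfl)⟩, fun _ _ => rfl⟩
    · let z : LinearMap.GeneralLinearGroup ks (ks ⊗[k] W) :=
        Units.map (algebraMap ks (Module.End ks (ks ⊗[k] W))).toMonoidHom (-1)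
      have hz : ∀ y : LinearMap.GeneralLinearGroup ks (ks ⊗[k] W), z * y = y * z := fun y =>
        Units.ext (Algebra.commutes (-1 : ks) (y : Module.End ks (ks ⊗[k] W)))
      have hzσ : ∀ σ : ks ≃ₐ[k] ks, σ • z = z := fun σ => Units.ext (by
        change galEnd ks σ (algebraMap ks _ (-1)) = algebraMap ks _ (-1)
        rw [galEnd_algebraMap, map_neg, map_one])
      have hze : ((z * e : LinearMap.GeneralLinearGroup ks (ks ⊗[k] W)) :
          Module.End ks (ks ⊗[k] W)) = (-1 : ks) • (e : Module.End ks (ks ⊗[k] W)) := by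
        rw [Algebra.smul_def]
        rfl
      refine ⟨z * e, ⟨⟨fun v w => ?_, ?_⟩, ?_⟩, fun σ x => ?_⟩
      · rw [hze, LinearMap.smul_apply, LinearMap.smul_apply, map_smul, map_smul,
          LinearMap.smul_apply, hiso, smul_smul]
        simp
      · rw [hze, LinearMap.det_smul, hd, Module.finrank_baseChange, hB.odd.neg_one_pow]
        simp
      · rw [hze]
        exact (hecomm _ (Algebra.subset_adjoin rfl)).smul_left _
      · rw [smul_mul', hzσ, hz (σ • e), mul_inv_rev, mul_assoc z, hz]
        group
  refine Quotient.sound (s := cohomologous _ _) ⟨⟨s, hs⟩⁻¹, fun σ => Subtype.ext ?_⟩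
  change h'⁻¹ * σ • h' = (s⁻¹)⁻¹ * (h⁻¹ * σ • h) * σ • s⁻¹
  have hmσ : σ • m = m := Units.ext (by rw [coe_smul, hm, galEnd_baseChange])
  have hc : m * (h⁻¹ * σ • h) = (h⁻¹ * σ • h) * m := Units.ext
    (((commute_of_mem_adjoin hmm hh.1).units_inv_right).mul_right
      (commute_of_mem_adjoin hmm (galEnd_mem_adjoin ks σ hh.1)))
  rw [inv_inv, smul_inv', hse]
  simp only [e, smul_mul', smul_inv', hmσ]
  rw [mul_assoc (h'⁻¹ * h), hc]
  group

/-- The class in `H¹(k, G_T)` of the cocycles `σ ↦ h⁻¹ σ(h)` with `h ∈ (L ⊗ kˢ)*`, `h* h = A`. -/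
def kummerClass (ks : Type*) [Field ks] [Algebra k ks] [IsSepClosure k ks] (hB : IsRegular B T)
    (hA : IsKummerDatum B T A) : H1 (ks ≃ₐ[k] ks) (stabilizer ks B T) :=
  haveI : Algebra.IsSeparable k ks := IsSepClosure.separable
  H1.mk (kummerCocycle hB hA (exists_kummerElement (ks := ks) hB hA).choose
    (exists_kummerElement hB hA).choose_spec)

end Connecting

/-! ## The étale algebras `L`, `E`, `K` -/

section Algebras

variable {k : Type*} [Field k]

theorem matrix_det_aeval {F m : Type*} [Field F] [IsAlgClosed F] [Fintype m] [DecidableEq m]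
    (A : Matrix m m F) (p : F[X]) :
    (aeval A p).det = p.leadingCoeff ^ A.charpoly.natDegree *
      (p.roots.map fun s => (-1) ^ A.charpoly.natDegree * A.charpoly.eval s).prod := by
  conv_lhs => rw [(IsAlgClosed.splits p).eq_prod_roots]
  rw [map_mul, aeval_C, Matrix.det_mul, Matrix.charpoly_natDegree_eq_dim,
    Matrix.algebraMap_eq_diagonal, Matrix.det_diagonal]
  congr 1
  · simp
  · induction p.roots using Multiset.induction_on with
    | empty => simp
    | cons s t ih =>
      rw [Multiset.map_cons, Multiset.prod_cons, map_mul, Matrix.det_mul, ih, Multiset.map_cons,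
        Multiset.prod_cons, Matrix.eval_charpoly, ← Matrix.det_neg]
      congr 2
      simp [Matrix.scalar_apply, Matrix.algebraMap_eq_diagonal]

theorem det_aeval {V : Type*} [AddCommGroup V] [Module k V] [FiniteDimensional k V]
    (M : Module.End k V) (p : k[X]) :
    algebraMap k (AlgebraicClosure k) (LinearMap.det (aeval M p)) =
      (p.map (algebraMap k (AlgebraicClosure k))).leadingCoeff ^
        (M.charpoly.map (algebraMap k (AlgebraicClosure k))).natDegree *
      ((p.map (algebraMap k (AlgebraicClosure k))).roots.map fun s =>
        (-1) ^ (M.charpoly.map (algebraMap k (AlgebraicClosure k))).natDegree *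
          (M.charpoly.map (algebraMap k (AlgebraicClosure k))).eval s).prod := by
  classical
  let b := Module.finBasis k V
  have h1 : (M.charpoly.map (algebraMap k (AlgebraicClosure k))) =
      ((LinearMap.toMatrix b b M).map (algebraMap k (AlgebraicClosure k))).charpoly := by
    rw [← LinearMap.charpoly_toMatrix M b, ← Matrix.charpoly_map]
  rw [h1, ← matrix_det_aeval, ← LinearMap.det_toMatrix b, RingHom.map_det]
  congr 1
  have h2 : LinearMap.toMatrix b b (aeval M p) = aeval (LinearMap.toMatrix b b M) p :=
    (Polynomial.aeval_algHom_apply (LinearMap.toMatrixAlgEquiv b).toAlgHom M p).symm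
  rw [h2, aeval_map_algebraMap]
  exact (Polynomial.aeval_algHom_apply
    ((Algebra.ofId k (AlgebraicClosure k)).mapMatrix) (LinearMap.toMatrix b b M) p).symm

theorem det_aeval_eq {V V' : Type*} [AddCommGroup V] [Module k V] [FiniteDimensional k V]
    [AddCommGroup V'] [Module k V'] [FiniteDimensional k V'] (M : Module.End k V)
    (M' : Module.End k V') (h : M.charpoly = M'.charpoly) (p : k[X]) :
    LinearMap.det (aeval M p) = LinearMap.det (aeval M' p) := by
  apply (algebraMap k (AlgebraicClosure k)).injective
  rw [det_aeval, det_aeval, h]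

theorem norm_adjoinRoot {f : k[X]} (hf : f.Monic) {V : Type*} [AddCommGroup V] [Module k V]
    [FiniteDimensional k V] (M : Module.End k V) (h : M.charpoly = f) (p : k[X]) :
    Algebra.norm k (AdjoinRoot.mk f p) = LinearMap.det (aeval M p) := by
  classical
  have := hf.finite_adjoinRoot
  have h1 : (Algebra.lmul k (AdjoinRoot f) (AdjoinRoot.root f)).charpoly = f := by
    have := charpoly_leftMulMatrix (AdjoinRoot.powerBasis' hf)
    rw [Algebra.leftMulMatrix_apply] at this
    have h3 := LinearMap.charpoly_toMatrix (Algebra.lmul k (AdjoinRoot f) (AdjoinRoot.root f))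
      (AdjoinRoot.powerBasis' hf).basis
    rw [← h3]
    refine this.trans ?_
    change minpoly k (AdjoinRoot.root f) = f
    rw [AdjoinRoot.minpoly_root hf.ne_zero, hf.leadingCoeff]
    simp
  rw [det_aeval_eq M _ (h.trans h1.symm) p, Algebra.norm_apply, ← AdjoinRoot.aeval_eq]
  congr 1
  exact (Polynomial.aeval_algHom_apply (Algebra.lmul k (AdjoinRoot f)) (AdjoinRoot.root f) p).symm

/-- `α(T)` for `α ∈ L = k[x]/(f)`, where `f` is monic and `f(T) = 0`. -/
def evalOp {W : Type*} [AddCommGroup W] [Module k W] {f : k[X]} (hf : f.Monic)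
    (T : Module.End k W) (α : AdjoinRoot f) : Module.End k W :=
  aeval T (AdjoinRoot.modByMonicHom hf α)

theorem evalOp_mk {W : Type*} [AddCommGroup W] [Module k W] {f : k[X]} (hf : f.Monic)
    {T : Module.End k W} (hT : aeval T f = 0) (p : k[X]) :
    evalOp hf T (AdjoinRoot.mk f p) = aeval T p := by
  rw [evalOp, AdjoinRoot.modByMonicHom_mk]
  conv_rhs => rw [← modByMonic_add_div p f, map_add, map_mul, hT, zero_mul, add_zero]

theorem evalOp_mul {W : Type*} [AddCommGroup W] [Module k W] {f : k[X]} (hf : f.Monic)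
    {T : Module.End k W} (hT : aeval T f = 0) (α β : AdjoinRoot f) :
    evalOp hf T (α * β) = evalOp hf T α * evalOp hf T β := by
  induction α using AdjoinRoot.induction_on
  induction β using AdjoinRoot.induction_on
  rw [← map_mul, evalOp_mk hf hT, evalOp_mk hf hT, evalOp_mk hf hT, map_mul]

theorem evalOp_isUnit {W : Type*} [AddCommGroup W] [Module k W] {f : k[X]} (hf : f.Monic)
    {T : Module.End k W} (hT : aeval T f = 0) {α : AdjoinRoot f} (hα : IsUnit α) :
    IsUnit (evalOp hf T α) := by
  obtain ⟨u, rfl⟩ := hα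
  have h1 : evalOp hf T 1 = 1 := by
    rw [← map_one (AdjoinRoot.mk f), evalOp_mk hf hT, map_one]
  refine ⟨⟨evalOp hf T u, evalOp hf T ↑u⁻¹, ?_, ?_⟩, rfl⟩
  · rw [← evalOp_mul hf hT, Units.mul_inv, h1]
  · rw [← evalOp_mul hf hT, Units.inv_mul, h1]

theorem evalOp_mem {W : Type*} [AddCommGroup W] [Module k W] {f : k[X]} (hf : f.Monic)
    (T : Module.End k W) (α : AdjoinRoot f) : evalOp hf T α ∈ Algebra.adjoin k {T} := by
  rw [Algebra.adjoin_singleton_eq_range_aeval]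
  exact ⟨_, rfl⟩

/-- `f(x) = x g(x²)`. -/
abbrev oddPoly (g : k[X]) : k[X] := X * expand k 2 g

/-- `K = k[x]/(g(x))`. -/
abbrev algK (g : k[X]) : Type _ := AdjoinRoot g

/-- `E = k[x]/(g(x²))`. -/
abbrev algE (g : k[X]) : Type _ := AdjoinRoot (expand k 2 g)

/-- The map `K → E` sending `x` to `x²`. -/
def mapKE (g : k[X]) : algK g →ₐ[k] algE g :=
  AdjoinRoot.liftAlgHom g (Algebra.ofId k _) (AdjoinRoot.root _ ^ 2) (by
    change aeval (AdjoinRoot.root (expand k 2 g) ^ 2) g = 0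
    rw [← expand_aeval, AdjoinRoot.aeval_eq, AdjoinRoot.mk_self])

/-- `E` is a `K`-algebra through `x ↦ x²`. -/
instance algebraKE (g : k[X]) : Algebra (algK g) (algE g) := (mapKE g).toRingHom.toAlgebra

theorem algebraMap_KE (g p : k[X]) : algebraMap (algK g) (algE g) (AdjoinRoot.mk g p) =
    AdjoinRoot.mk _ (expand k 2 p) := by
  change aeval (AdjoinRoot.root (expand k 2 g) ^ 2) p = _
  rw [← expand_aeval, AdjoinRoot.aeval_eq]

instance isScalarTowerKE (g : k[X]) : IsScalarTower k (algK g) (algE g) :=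
  IsScalarTower.of_algebraMap_eq fun r => ((mapKE g).commutes r).symm

theorem root_sq (g : k[X]) :
    (AdjoinRoot.root (X ^ 2 - C (AdjoinRoot.root g) : (algK g)[X])) ^ 2 =
      algebraMap (algK g) _ (AdjoinRoot.root g) := by
  have := AdjoinRoot.mk_self (f := (X ^ 2 - C (AdjoinRoot.root g) : (algK g)[X]))
  rwa [map_sub, map_pow, AdjoinRoot.mk_X, AdjoinRoot.mk_C, sub_eq_zero] at this

theorem aeval_root_expand (g : k[X]) :
    aeval (AdjoinRoot.root (X ^ 2 - C (AdjoinRoot.root g) : (algK g)[X])) (expand k 2 g) = 0 := by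
  rw [expand_aeval, root_sq, aeval_algebraMap_apply, AdjoinRoot.aeval_eq, AdjoinRoot.mk_self,
    map_zero]

/-- `E = K[y]/(y² - β)`, where `β ∈ K` is the class of `x`. -/
def equivE (g : k[X]) :
    algE g ≃ₐ[algK g] AdjoinRoot (X ^ 2 - C (AdjoinRoot.root g) : (algK g)[X]) := by
  let φ : algE g →ₐ[k] AdjoinRoot (X ^ 2 - C (AdjoinRoot.root g) : (algK g)[X]) :=
    AdjoinRoot.liftAlgHom _ (Algebra.ofId k _) (AdjoinRoot.root _) (aeval_root_expand g)
  have hφ : φ (AdjoinRoot.root _) = AdjoinRoot.root _ := AdjoinRoot.liftAlgHom_root _ _ _ _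
  have hφK : ∀ x : algK g, φ (algebraMap _ _ x) = algebraMap _ _ x := by
    intro x
    have : (φ.comp (mapKE g)) = IsScalarTower.toAlgHom k (algK g) _ := by
      apply AdjoinRoot.algHom_ext
      simp only [AlgHom.comp_apply, mapKE, AdjoinRoot.liftAlgHom_root, map_pow, hφ, root_sq]
      rfl
    exact DFunLike.congr_fun this x
  let φ' : algE g →ₐ[algK g] AdjoinRoot (X ^ 2 - C (AdjoinRoot.root g) : (algK g)[X]) :=
    { φ with commutes' := hφK }
  let ψ : AdjoinRoot (X ^ 2 - C (AdjoinRoot.root g) : (algK g)[X]) →ₐ[algK g] algE g :=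
    AdjoinRoot.liftAlgHom _ (Algebra.ofId _ _) (AdjoinRoot.root _) (by
      change aeval (AdjoinRoot.root (expand k 2 g)) (X ^ 2 - C (AdjoinRoot.root g) : (algK g)[X]) = 0
      have h1 := algebraMap_KE g X
      rw [AdjoinRoot.mk_X, expand_X, map_pow, AdjoinRoot.mk_X] at h1
      rw [map_sub, map_pow, aeval_X, aeval_C]
      exact sub_eq_zero.2 h1.symm)
  have hψ : ψ (AdjoinRoot.root _) = AdjoinRoot.root _ := AdjoinRoot.liftAlgHom_root _ _ _ _
  refine AlgEquiv.ofAlgHom φ' ψ ?_ ?_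
  · apply AdjoinRoot.algHom_ext
    rw [AlgHom.comp_apply, hψ]
    exact hφ
  · have : ((ψ.comp φ').restrictScalars k) = AlgHom.id k (algE g) := by
      apply AdjoinRoot.algHom_ext
      change ψ (φ (AdjoinRoot.root _)) = AdjoinRoot.root _
      rw [hφ, hψ]
    exact AlgHom.ext fun x => DFunLike.congr_fun this x

theorem root_sq_E (g : k[X]) : AdjoinRoot.root (expand k 2 g) * AdjoinRoot.root (expand k 2 g) =
    algebraMap (algK g) (algE g) (AdjoinRoot.root g) := by
  have h1 := algebraMap_KE g X
  rw [AdjoinRoot.mk_X, expand_X, map_pow, AdjoinRoot.mk_X] at h1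
  rw [h1, sq]

theorem equivE_root (g : k[X]) :
    equivE g (AdjoinRoot.root (expand k 2 g)) = AdjoinRoot.root _ :=
  AdjoinRoot.liftAlgHom_root (expand k 2 g) (Algebra.ofId k _) (AdjoinRoot.root _)
    (aeval_root_expand g)

theorem exists_basis_two {R S : Type*} [CommRing R] [CommRing S] [Algebra R S]
    (pb : PowerBasis R S) (hd : pb.dim = 2) :
    ∃ b : Module.Basis (Fin 2) R S, b 0 = 1 ∧ b 1 = pb.gen := by
  refine ⟨pb.basis.reindex (finCongr hd), ?_, ?_⟩
  · rw [Module.Basis.reindex_apply, pb.basis_eq_pow]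
    simp
  · rw [Module.Basis.reindex_apply, pb.basis_eq_pow]
    simp

theorem exists_basis_E (g : k[X]) [Nontrivial (algK g)] :
    ∃ b : Module.Basis (Fin 2) (algK g) (algE g), b 0 = 1 ∧ b 1 = AdjoinRoot.root _ := by
  have hm : (X ^ 2 - C (AdjoinRoot.root g) : (algK g)[X]).Monic :=
    monic_X_pow_sub_C (AdjoinRoot.root g) two_ne_zero
  obtain ⟨b, h0, h1⟩ := exists_basis_two (AdjoinRoot.powerBasis' hm) (by
    rw [AdjoinRoot.powerBasis'_dim, natDegree_X_pow_sub_C])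
  rw [AdjoinRoot.powerBasis'_gen, ← equivE_root] at h1
  refine ⟨b.map (equivE g).symm.toLinearEquiv, ?_, ?_⟩
  · simp [h0]
  · simp [h1]

/-- The involution `x ↦ -x` of `E`. -/
def tauE (g : k[X]) : algE g →ₐ[k] algE g :=
  AdjoinRoot.liftAlgHom _ (Algebra.ofId k _) (-AdjoinRoot.root _) (by
    change aeval (-AdjoinRoot.root (expand k 2 g)) (expand k 2 g) = 0
    rw [expand_aeval, neg_sq, ← expand_aeval, AdjoinRoot.aeval_eq, AdjoinRoot.mk_self])

theorem tauE_algebraMap (g : k[X]) (κ : algK g) :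
    tauE g (algebraMap (algK g) (algE g) κ) = algebraMap (algK g) (algE g) κ := by
  induction κ using AdjoinRoot.induction_on with
  | ih p =>
    rw [algebraMap_KE]
    change aeval (-AdjoinRoot.root (expand k 2 g)) (expand k 2 p) = _
    rw [expand_aeval, neg_sq, ← expand_aeval, AdjoinRoot.aeval_eq]

theorem tauE_root (g : k[X]) : tauE g (AdjoinRoot.root _) = -AdjoinRoot.root _ :=
  AdjoinRoot.liftAlgHom_root _ _ _ _

/-- The norm from `E` to `K` is `ε ↦ ε ε^τ`. -/
theorem norm_E (g : k[X]) (ε : algE g) :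
    algebraMap (algK g) (algE g) (Algebra.norm (algK g) ε) = ε * tauE g ε := by
  classical
  rcases subsingleton_or_nontrivial (algK g) with h | h
  · have := Module.subsingleton (algK g) (algE g)
    exact Subsingleton.elim _ _
  obtain ⟨b, h0, h1⟩ := exists_basis_E g
  have hε := b.sum_repr ε
  rw [Fin.sum_univ_two, h0, h1] at hε
  set a := b.repr ε 0
  set c := b.repr ε 1
  have e0 : ε * b 0 = a • b 0 + c • b 1 := by rw [h0, h1, hε, mul_one]
  have e1 : ε * b 1 = (c * AdjoinRoot.root g) • b 0 + a • b 1 := by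
    rw [h0, h1, ← hε]
    simp only [Algebra.smul_def, map_mul, ← root_sq_E]
    ring
  rw [Algebra.norm_eq_matrix_det b, Matrix.det_fin_two]
  simp only [Algebra.leftMulMatrix_eq_repr_mul, e0, e1, map_add, map_smul, b.repr_self,
    Finsupp.add_apply, Finsupp.smul_apply, Finsupp.single_apply]
  rw [← hε]
  simp only [Algebra.smul_def, map_mul, map_add, map_sub, tauE_algebraMap, tauE_root]
  simp [← root_sq_E]
  ring

theorem norm_KE (g : k[X]) (hg : g.Monic) (κ : algK g) :
    Algebra.norm k (algebraMap (algK g) (algE g) κ) = Algebra.norm k κ ^ 2 := by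
  rcases subsingleton_or_nontrivial (algK g) with h | h
  · rw [Subsingleton.elim κ 1]
    simp
  obtain ⟨b, -, -⟩ := exists_basis_E g
  have := hg.free_adjoinRoot
  have := Module.Free.of_basis b
  rw [← Algebra.norm_norm (S := algK g), Algebra.norm_algebraMap_of_basis b, map_pow]
  simp

end Algebras

/-! ## Skew self-adjoint operators -/

section Skew

variable {k : Type*} [Field k]

theorem oddPoly_monic {g : k[X]} (hg : g.Monic) : (oddPoly g).Monic :=
  monic_X.mul (hg.expand two_pos)

/-- The involution `x ↦ -x` of `L = k[x]/(x g(x²))`. -/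
def tauL (g : k[X]) : AdjoinRoot (oddPoly g) →ₐ[k] AdjoinRoot (oddPoly g) :=
  AdjoinRoot.liftAlgHom _ (Algebra.ofId k _) (-AdjoinRoot.root _) (by
    change aeval (-AdjoinRoot.root (oddPoly g)) (oddPoly g) = 0
    rw [map_mul, aeval_X, expand_aeval, neg_sq, ← expand_aeval, neg_mul, neg_eq_zero]
    have := AdjoinRoot.mk_self (f := oddPoly g)
    rwa [← AdjoinRoot.aeval_eq, map_mul, aeval_X] at this)

/-- The projection `L → E`. -/
def projE (g : k[X]) : AdjoinRoot (oddPoly g) →ₐ[k] algE g :=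
  AdjoinRoot.liftAlgHom _ (Algebra.ofId k _) (AdjoinRoot.root _) (by
    change aeval (AdjoinRoot.root (expand k 2 g)) (oddPoly g) = 0
    rw [map_mul, AdjoinRoot.aeval_eq (expand k 2 g), AdjoinRoot.mk_self, mul_zero])

/-- The projection `L → k` sending `x` to `0`. -/
def projk (g : k[X]) : AdjoinRoot (oddPoly g) →ₐ[k] k :=
  AdjoinRoot.liftAlgHom _ (Algebra.ofId k _) 0 (by
    change aeval (0 : k) (oddPoly g) = 0
    rw [map_mul, aeval_X, zero_mul])

theorem projE_mk (g p : k[X]) : projE g (AdjoinRoot.mk _ p) = AdjoinRoot.mk _ p := by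
  change aeval (AdjoinRoot.root (expand k 2 g)) p = _
  rw [AdjoinRoot.aeval_eq]

theorem projk_mk (g p : k[X]) : projk g (AdjoinRoot.mk _ p) = p.eval 0 := by
  change aeval (0 : k) p = _
  rw [coe_aeval_eq_eval]

theorem eval_zero_ne {g : k[X]} (hsep : (oddPoly g).Separable) : g.eval 0 ≠ 0 := by
  intro h
  obtain ⟨a, b, hab⟩ := hsep.isCoprime
  have := congrArg (eval 0) hab
  simp [expand_eval, h] at this

/-- The decomposition `L = E ⊕ k` for `f = x g(x²)` separable. -/
def equivL {g : k[X]} (hsep : (oddPoly g).Separable) :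
    AdjoinRoot (oddPoly g) ≃ₐ[k] algE g × k :=
  AlgEquiv.ofBijective ((projE g).prod (projk g)) (by
    constructor
    · rw [injective_iff_map_eq_zero]
      intro α hα
      induction α using AdjoinRoot.induction_on with
      | ih p =>
        rw [AlgHom.prod_apply, projE_mk, projk_mk, Prod.mk_eq_zero, AdjoinRoot.mk_eq_zero] at hα
        rw [AdjoinRoot.mk_eq_zero]
        refine IsCoprime.mul_dvd hsep.isCoprime ?_ hα.1
        rw [X_dvd_iff, coeff_zero_eq_eval_zero]
        exact hα.2
    · rintro ⟨ε, c⟩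
      induction ε using AdjoinRoot.induction_on with
      | ih p =>
        refine ⟨AdjoinRoot.mk _ (p + expand k 2 g * C ((c - p.eval 0) / g.eval 0)), ?_⟩
        have := eval_zero_ne hsep
        rw [AlgHom.prod_apply, projE_mk, projk_mk]
        refine Prod.ext ?_ ?_
        · simp
        · simp [expand_eval]
          field_simp
          ring)

theorem equivL_mk {g : k[X]} (hsep : (oddPoly g).Separable) (p : k[X]) :
    equivL hsep (AdjoinRoot.mk _ p) = (AdjoinRoot.mk _ p, p.eval 0) := by
  rw [← projE_mk, ← projk_mk]
  rfl

/-- The element `α = (κ, 1)` of `K* × k* ⊂ L*` attached to `κ ∈ K*`. -/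
def alpha {g : k[X]} (hsep : (oddPoly g).Separable) (κ : (algK g)ˣ) : AdjoinRoot (oddPoly g) :=
  (equivL hsep).symm (algebraMap (algK g) (algE g) κ, 1)

theorem exists_alpha_eq {g : k[X]} (hsep : (oddPoly g).Separable) (κ : (algK g)ˣ) :
    ∃ P : k[X], alpha hsep κ = AdjoinRoot.mk _ (expand k 2 P) := by
  have h0 := eval_zero_ne hsep
  obtain ⟨p, hp⟩ := AdjoinRoot.mk_surjective (κ : algK g)
  refine ⟨p + g * C ((1 - p.eval 0) / g.eval 0), ?_⟩
  rw [alpha, AlgEquiv.symm_apply_eq, equivL_mk, ← hp, algebraMap_KE]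
  refine Prod.ext ?_ ?_
  · simp
  · simp [expand_eval]
    field_simp
    ring

theorem norm_equivL {g : k[X]} (hg : g.Monic) (hsep : (oddPoly g).Separable)
    (α : AdjoinRoot (oddPoly g)) :
    Algebra.norm k α = Algebra.norm k (equivL hsep α).1 * (equivL hsep α).2 := by
  have := (hg.expand two_pos).finite_adjoinRoot
  rw [← Algebra.norm_eq_of_algEquiv (equivL hsep)]
  generalize equivL hsep α = x
  rw [Algebra.norm_apply, Algebra.norm_apply]
  have : LinearMap.mul k (algE g × k) x =
      (LinearMap.mul k (algE g) x.1).prodMap (LinearMap.mul k k x.2) := by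
    refine LinearMap.ext fun y => ?_
    rfl
  change LinearMap.det (LinearMap.mul k (algE g × k) x) = _
  rw [this, LinearMap.det_prodMap]
  congr 1
  simp [LinearMap.det_ring]

theorem norm_alpha {g : k[X]} (hg : g.Monic) (hsep : (oddPoly g).Separable) (κ : (algK g)ˣ) :
    Algebra.norm k (alpha hsep κ) = Algebra.norm k (κ : algK g) ^ 2 := by
  rw [norm_equivL hg hsep, alpha, AlgEquiv.apply_symm_apply, mul_one, norm_KE g hg]

theorem alpha_isUnit {g : k[X]} (hsep : (oddPoly g).Separable) (κ : (algK g)ˣ) :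
    IsUnit (alpha hsep κ) := by
  refine IsUnit.map (equivL hsep).symm ?_
  rw [Prod.isUnit_iff]
  exact ⟨κ.isUnit.map (algebraMap (algK g) (algE g)), isUnit_one⟩

variable {W : Type*} [AddCommGroup W] [Module k W] [FiniteDimensional k W]

/-- `T` is skew self-adjoint with characteristic polynomial `f`. -/
structure IsSkewOp (B : LinearMap.BilinForm k W) (f : k[X]) (T : Module.End k W) : Prop where
  skew : ∀ v w, B (T v) w = -B v (T w)
  charpoly : T.charpoly = f

theorem isRegular_of {n : ℕ} {B : LinearMap.BilinForm k W} {T : Module.End k W} {f : k[X]}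
    (h2 : (2 : k) ≠ 0) (hB : IsSplitOrthogonal n B) (hT : T.charpoly = f) (hf : f.Separable) :
    IsRegular B T where
  two_ne_zero := h2
  symm := hB.symm
  nondegenerate := hB.nondegenerate
  odd := ⟨n, hB.finrank⟩
  separable := hT ▸ hf

theorem aeval_eq_zero {T : Module.End k W} {f : k[X]} (hT : T.charpoly = f) : aeval T f = 0 :=
  hT ▸ LinearMap.aeval_self_charpoly T

/-- The distinguished operators: those isometric to multiplication by `x` on `L` with the form
`⟨λ, μ⟩ =` the coefficient of `x²ⁿ` in `(-1)ⁿ λ μ^τ`. -/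
def IsDistinguishedSkew (n : ℕ) {g : k[X]} (hg : g.Monic) (B : LinearMap.BilinForm k W)
    (T : Module.End k W) : Prop :=
  ∃ θ : AdjoinRoot (oddPoly g) ≃ₗ[k] W,
    (∀ l m, B (θ l) (θ m) =
      (-1) ^ n * (AdjoinRoot.modByMonicHom (oddPoly_monic hg) (l * tauL g m)).coeff (2 * n)) ∧
    ∀ l, T (θ l) = θ (AdjoinRoot.root _ * l)

variable {n : ℕ} {B : LinearMap.BilinForm k W} {g : k[X]} {T : Module.End k W}

theorem skew_datum (hg : g.Monic) (hsep : (oddPoly g).Separable) (hT : IsSkewOp B (oddPoly g) T)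
    (κ : (algK g)ˣ) : IsKummerDatum B T (evalOp (oddPoly_monic hg) T (alpha hsep κ)) where
  mem := evalOp_mem _ _ _
  isUnit := evalOp_isUnit _ (aeval_eq_zero hT.charpoly) (alpha_isUnit hsep κ)
  selfAdjoint := by
    obtain ⟨P, hP⟩ := exists_alpha_eq hsep κ
    rw [hP, evalOp_mk _ (aeval_eq_zero hT.charpoly), expand_aeval]
    refine adjoin_selfAdjoint (A := T ^ 2) (fun v w => ?_) ?_
    · rw [sq, Module.End.mul_apply, Module.End.mul_apply, hT.skew, hT.skew, neg_neg]
    · rw [Algebra.adjoin_singleton_eq_range_aeval]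
      exact ⟨P, rfl⟩
  det := by
    refine ⟨Algebra.norm k (κ : algK g), ?_⟩
    rw [← norm_alpha hg hsep]
    obtain ⟨P, hP⟩ := exists_alpha_eq hsep κ
    rw [hP, evalOp_mk _ (aeval_eq_zero hT.charpoly),
      norm_adjoinRoot (oddPoly_monic hg) T hT.charpoly]

/-- `NE* ⊂ K*`. -/
def normSubgroup (g : k[X]) : Subgroup (algK g)ˣ :=
  (Units.map (Algebra.norm (algK g) : algE g →* algK g)).range

theorem adjoint_aeval (hT : IsSkewOp B (oddPoly g) T) (q : k[X]) (v w : W) :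
    B v (aeval T q w) = B (aeval T (q.comp (-X)) v) w := by
  induction q using Polynomial.induction_on' generalizing v with
  | add p q hp hq => simp [hp, hq]
  | monomial m a =>
    rw [← C_mul_X_pow_eq_monomial]
    simp only [mul_comp, C_comp, pow_comp, X_comp, map_mul, map_pow, map_neg, aeval_X, aeval_C,
      Module.End.mul_apply, Module.algebraMap_end_apply, map_smul, LinearMap.smul_apply]
    congr 1
    induction m generalizing v with
    | zero => simp
    | succ m ih =>
      rw [pow_succ', Module.End.mul_apply, pow_succ, Module.End.mul_apply, ← ih]
      rw [LinearMap.neg_apply, map_neg, LinearMap.neg_apply, hT.skew, neg_neg]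

theorem skew_wellDefined (hg : g.Monic) (hsep : (oddPoly g).Separable)
    (hT : IsSkewOp B (oddPoly g) T) (κ κ' : (algK g)ˣ) (h : κ⁻¹ * κ' ∈ normSubgroup g) :
    ∃ l ∈ Algebra.adjoin k {T}, IsUnit l ∧
      ∀ v w, B (evalOp (oddPoly_monic hg) T (alpha hsep κ') v) w =
        B (evalOp (oddPoly_monic hg) T (alpha hsep κ) (l v)) (l w) := by
  obtain ⟨ε, hε⟩ := h
  have hε' : (κ' : algK g) = κ * Algebra.norm (algK g) (ε : algE g) := by
    have := congrArg Units.val (eq_inv_mul_iff_mul_eq.1 hε)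
    simpa using this.symm
  have hT0 := aeval_eq_zero hT.charpoly
  obtain ⟨q, hq⟩ := AdjoinRoot.mk_surjective ((equivL hsep).symm ((ε : algE g), 1))
  have hq' := hq
  rw [AlgEquiv.eq_symm_apply, equivL_mk, Prod.mk.injEq] at hq'
  refine ⟨aeval T q, ?_, ?_, fun v w => ?_⟩
  · rw [Algebra.adjoin_singleton_eq_range_aeval]
    exact ⟨q, rfl⟩
  · rw [← evalOp_mk (oddPoly_monic hg) hT0, hq]
    refine evalOp_isUnit _ hT0 (IsUnit.map (equivL hsep).symm ?_)
    rw [Prod.isUnit_iff]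
    exact ⟨ε.isUnit, isUnit_one⟩
  · rw [adjoint_aeval hT, ← evalOp_mk (oddPoly_monic hg) hT0, ← evalOp_mk (oddPoly_monic hg) hT0,
      ← Module.End.mul_apply, ← Module.End.mul_apply, ← evalOp_mul _ hT0, ← evalOp_mul _ hT0]
    congr 4
    apply (equivL hsep).injective
    rw [map_mul, map_mul, equivL_mk, equivL_mk, hq'.1, hq'.2, alpha, alpha,
      AlgEquiv.apply_symm_apply, AlgEquiv.apply_symm_apply, hε', map_mul, norm_E]
    have : AdjoinRoot.mk (expand k 2 g) (q.comp (-X)) = tauE g ε := by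
      rw [← hq'.1]
      change _ = aeval (-AdjoinRoot.root (expand k 2 g)) q
      rw [← AdjoinRoot.aeval_eq, aeval_comp]
      simp
    rw [this, eval_comp]
    refine Prod.ext ?_ ?_
    · simp only [Prod.fst_mul]
      ring
    · simp [hq'.2]

/-- The connecting map `K*/NE* → H¹(k, G_T)`: the class of `κ` is sent to the class of the cocycle
`σ ↦ h⁻¹ σ(h)`, where `h ∈ (L ⊗ kˢ)*` satisfies `h* h = α = (κ, 1)`. -/
def deltaSkew (ks : Type*) [Field ks] [Algebra k ks] [IsSepClosure k ks] (h2 : (2 : k) ≠ 0)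
    (hB : IsSplitOrthogonal n B) (hg : g.Monic) (hsep : (oddPoly g).Separable)
    (hT : IsSkewOp B (oddPoly g) T) :
    (algK g)ˣ ⧸ normSubgroup g → H1 (ks ≃ₐ[k] ks) (stabilizer ks B T) :=
  Quotient.lift
    (fun κ => kummerClass ks (isRegular_of h2 hB hT.charpoly hsep) (skew_datum hg hsep hT κ))
    fun κ κ' h => by
      have := IsSepClosure.separable (k := k) (K := ks)
      exact kummerCocycle_eq _ _ _ _ _
        (skew_wellDefined hg hsep hT κ κ' (QuotientGroup.leftRel_apply.1 h))

/-- The map `γ : K*/NE* → H¹(k, SO(W))`. -/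
def gammaSkew (ks : Type*) [Field ks] [Algebra k ks] [IsSepClosure k ks] (h2 : (2 : k) ≠ 0)
    (hB : IsSplitOrthogonal n B) (hg : g.Monic) (hsep : (oddPoly g).Separable)
    (hT : IsSkewOp B (oddPoly g) T) (c : (algK g)ˣ ⧸ normSubgroup g) :
    H1 (ks ≃ₐ[k] ks) (SOs ks B) :=
  stabilizerMap ks B T (deltaSkew ks h2 hB hg hsep hT c)

end Skew

/-! ## Self-adjoint operators -/

section SelfAdjoint

variable {k : Type*} [Field k]

/-- The subgroup `A*²` of squares of the unit group of a commutative ring. -/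
def squares (A : Type*) [CommRing A] : Subgroup Aˣ := (powMonoidHom 2 : Aˣ →* Aˣ).range

/-- The norm `L*/L*² → k*/k*²`, where `L = k[x]/(f)`. -/
def normMod (f : k[X]) :
    (AdjoinRoot f)ˣ ⧸ squares (AdjoinRoot f) →* kˣ ⧸ squares k :=
  QuotientGroup.map _ _ (Units.map (Algebra.norm k : AdjoinRoot f →* k)) (by
    rintro _ ⟨u, rfl⟩
    exact ⟨Units.map (Algebra.norm k : AdjoinRoot f →* k) u, by simp⟩)

/-- `(L*/L*²)_{N=1}`. -/
abbrev normOne (f : k[X]) : Subgroup ((AdjoinRoot f)ˣ ⧸ squares (AdjoinRoot f)) := (normMod f).ker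

theorem norm_sq_of_mem {f : k[X]} {α : (AdjoinRoot f)ˣ}
    (h : (QuotientGroup.mk α : (AdjoinRoot f)ˣ ⧸ squares (AdjoinRoot f)) ∈ normOne f) :
    ∃ c : k, Algebra.norm k (α : AdjoinRoot f) = c ^ 2 := by
  rw [MonoidHom.mem_ker] at h
  have h1 : (QuotientGroup.mk (Units.map (Algebra.norm k : AdjoinRoot f →* k) α) : kˣ ⧸ squares k)
    = 1 := h
  rw [QuotientGroup.eq_one_iff] at h1
  obtain ⟨u, hu⟩ := h1
  refine ⟨u, ?_⟩
  have := congrArg Units.val hu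
  simpa using this.symm

variable {W : Type*} [AddCommGroup W] [Module k W] [FiniteDimensional k W]

/-- `T` is self-adjoint with characteristic polynomial `f`. -/
structure IsSelfAdjointOp (B : LinearMap.BilinForm k W) (f : k[X]) (T : Module.End k W) :
    Prop where
  selfAdjoint : ∀ v w, B (T v) w = B v (T w)
  charpoly : T.charpoly = f

/-- The distinguished operators: those isometric to multiplication by `x` on `L` with the form
`⟨λ, μ⟩ =` the coefficient of `x²ⁿ` in `λ μ`. -/
def IsDistinguishedSelfAdjoint (n : ℕ) {f : k[X]} (hf : f.Monic) (B : LinearMap.BilinForm k W)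
    (T : Module.End k W) : Prop :=
  ∃ θ : AdjoinRoot f ≃ₗ[k] W,
    (∀ l m, B (θ l) (θ m) = (AdjoinRoot.modByMonicHom hf (l * m)).coeff (2 * n)) ∧
    ∀ l, T (θ l) = θ (AdjoinRoot.root _ * l)

variable {n : ℕ} {B : LinearMap.BilinForm k W} {f : k[X]} {T : Module.End k W}

theorem selfAdjoint_wellDefined (hf : f.Monic) (hT : IsSelfAdjointOp B f T) (β α : (AdjoinRoot f)ˣ)
    (h : (QuotientGroup.mk β : (AdjoinRoot f)ˣ ⧸ squares (AdjoinRoot f)) = QuotientGroup.mk α) :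
    ∃ l ∈ Algebra.adjoin k {T}, IsUnit l ∧
      ∀ v w, B (evalOp hf T α v) w = B (evalOp hf T β (l v)) (l w) := by
  obtain ⟨u, hu⟩ := QuotientGroup.eq.1 h
  have hT0 := aeval_eq_zero hT.charpoly
  have hα : (α : AdjoinRoot f) = u * (β * u) := by
    have := congrArg Units.val (eq_inv_mul_iff_mul_eq.1 hu)
    rw [← this]
    simp only [powMonoidHom_apply, Units.val_mul, Units.val_pow_eq_pow_val]
    ring
  refine ⟨evalOp hf T u, evalOp_mem _ _ _, evalOp_isUnit _ hT0 u.isUnit, fun v w => ?_⟩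
  rw [← adjoin_selfAdjoint hT.selfAdjoint (evalOp_mem hf T u), hα, evalOp_mul _ hT0,
    evalOp_mul _ hT0, Module.End.mul_apply, Module.End.mul_apply]

theorem selfAdjoint_datum (hf : f.Monic) (hT : IsSelfAdjointOp B f T) (α : (AdjoinRoot f)ˣ)
    (h : (QuotientGroup.mk α : (AdjoinRoot f)ˣ ⧸ squares (AdjoinRoot f)) ∈ normOne f) :
    IsKummerDatum B T (evalOp hf T α) where
  mem := evalOp_mem _ _ _
  isUnit := evalOp_isUnit _ (aeval_eq_zero hT.charpoly) α.isUnit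
  selfAdjoint := adjoin_selfAdjoint hT.selfAdjoint (evalOp_mem _ _ _)
  det := by
    obtain ⟨c, hc⟩ := norm_sq_of_mem h
    refine ⟨c, ?_⟩
    rw [← hc]
    obtain ⟨p, hp⟩ := AdjoinRoot.mk_surjective (α : AdjoinRoot f)
    rw [← hp, evalOp_mk _ (aeval_eq_zero hT.charpoly), norm_adjoinRoot hf T hT.charpoly]

/-- The connecting map `(L*/L*²)_{N=1} → H¹(k, G_T)`: the class of `α` is sent to the class of the
cocycle `σ ↦ h⁻¹ σ(h)`, where `h ∈ (L ⊗ kˢ)*` satisfies `h* h = h² = α`. It is defined here through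
a chosen representative `α`; by `deltaSelfAdjoint_mk` any other gives the same class. -/
def deltaSelfAdjoint (ks : Type*) [Field ks] [Algebra k ks] [IsSepClosure k ks] (h2 : (2 : k) ≠ 0)
    (hB : IsSplitOrthogonal n B) (hf : f.Monic) (hsep : f.Separable)
    (hT : IsSelfAdjointOp B f T) (c : normOne f) : H1 (ks ≃ₐ[k] ks) (stabilizer ks B T) :=
  kummerClass ks (isRegular_of h2 hB hT.charpoly hsep)
    (selfAdjoint_datum hf hT c.1.out (by rw [QuotientGroup.out_eq']; exact c.2))

theorem deltaSelfAdjoint_mk (ks : Type*) [Field ks] [Algebra k ks] [IsSepClosure k ks]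
    (h2 : (2 : k) ≠ 0) (hB : IsSplitOrthogonal n B) (hf : f.Monic) (hsep : f.Separable)
    (hT : IsSelfAdjointOp B f T) (α : (AdjoinRoot f)ˣ)
    (h : (QuotientGroup.mk α : (AdjoinRoot f)ˣ ⧸ squares (AdjoinRoot f)) ∈ normOne f) :
    deltaSelfAdjoint ks h2 hB hf hsep hT ⟨QuotientGroup.mk α, h⟩ =
      kummerClass ks (isRegular_of h2 hB hT.charpoly hsep) (selfAdjoint_datum hf hT α h) := by
  have := IsSepClosure.separable (k := k) (K := ks)
  exact kummerCocycle_eq _ _ _ _ _ (selfAdjoint_wellDefined hf hT _ _ (QuotientGroup.out_eq' _))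

/-- The map `γ : (L*/L*²)_{N=1} → H¹(k, SO(W))`. -/
def gammaSelfAdjoint (ks : Type*) [Field ks] [Algebra k ks] [IsSepClosure k ks] (h2 : (2 : k) ≠ 0)
    (hB : IsSplitOrthogonal n B) (hf : f.Monic) (hsep : f.Separable)
    (hT : IsSelfAdjointOp B f T) (c : normOne f) : H1 (ks ≃ₐ[k] ks) (SOs ks B) :=
  stabilizerMap ks B T (deltaSelfAdjoint ks h2 hB hf hsep hT c)

end SelfAdjoint

/-- `x` is the class in `H¹(k, G_T)` of the operator `S`: one has `S = g T g⁻¹` with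
`g ∈ SO(W)(kˢ)`, and `x` is the class of the cocycle `σ ↦ g⁻¹ σ(g)`. -/
def IsOrbitClass (ks : Type*) {k W : Type*} [Field k] [Field ks] [Algebra k ks]
    [AddCommGroup W] [Module k W] [FiniteDimensional k W] (B : LinearMap.BilinForm k W)
    (T S : Module.End k W) (x : H1 (ks ≃ₐ[k] ks) (stabilizer ks B T)) : Prop :=
  ∃ g ∈ SOs ks B, S.baseChange ks = (g : Module.End ks (ks ⊗[k] W)) * T.baseChange ks *
      (g⁻¹ : LinearMap.GeneralLinearGroup ks (ks ⊗[k] W)) ∧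
    ∃ a : Cocycle (ks ≃ₐ[k] ks) (stabilizer ks B T),
      (∀ σ, (a.toFun σ : LinearMap.GeneralLinearGroup ks (ks ⊗[k] W)) = g⁻¹ * σ • g) ∧ x = H1.mk a

end ArithInv

end

/-! Both parts rest on one linear-algebra correspondence. Let `s` be the sign in the adjointness
condition `B (T v) w = s * B v (T w)`: `s = 1` for self-adjoint operators and `s = -1` for skew
ones. Separability of the characteristic polynomial makes `W` free of rank one over `L = k[T]`, so
the centralizer of `T` is `L`, and any `S` of the same type satisfies `S u = u T` for some linear
`u` over `k`. Pulling the form back along `u` gives `⟨A v, w⟩`. Since `S` and `T` have the same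
adjointness, `A` commutes with `T`, so `A = α(T)` with `α` a unit of `L` fixed by the involution and
`N(α) = det(u)²`. Replacing `u` by `u l` with `l` in `L*` replaces `α` by `l* α l`. In odd dimension
every isometry is plus or minus an element of `SO`, so the rational orbits correspond to the classes
of those `α` whose twisted form is isometric to `W`. This is `IsTwist`, with `exists_isTwist`,
`IsTwist.mem_orbit` and `IsTwist.exists_commute`.

In the self-adjoint case `l* = l`, and the classes live in `L*/L*²` with square norm. In the skew
case `α` lies in `K* × k*`. The norm condition makes the `k`-component a square, so a scalar
normalizes it to `1`, and the `K`-component is left modulo norms from `E` (`exists_isTwist_alpha`,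
`mk_eq_of_isTwist_skew`).

For the cohomology, take `h` over `kˢ` with `h* h = α`. Then `u α⁻¹ h` is an isometry carrying `T`
to `S`, and its cocycle is `h⁻¹ σ(h)` because `u` and `α` are rational (`IsTwist.isOrbitClass`).
Conversely, if that cocycle becomes trivial in `SO(W)`, a trivializing element combines with `h` to
give a Galois-fixed operator, which descends to the required `u`
(`exists_isTwist_of_stabilizerMap_eq_base`). Orbits and classes are compared through `α` itself, so
neither injectivity of `δ` nor a computation of `H¹(k, G_T)` is needed.

Distinguished operators exist because `L` with its coefficient form has an explicit isotropic
subspace, spanned by `1, x, …, xⁿ⁻¹`, and a unit vector `xⁿ` orthogonal to it. Hence it has the same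
standard Gram matrix as `W`. -/

noncomputable section

namespace ArithInv

/-! ## Cyclic vectors -/

section Cyclic

variable {k W : Type*} [Field k] [AddCommGroup W] [Module k W]
  {f : k[X]} {T : Module.End k W}

/-- The determinant of `q(T)` depends only on `f`: it is the norm of `q` from `k[x]/(f)`. If `f = q
r` with `q` not a unit, then `r` is a nonzero element killed by `q`, so this norm vanishes. -/
theorem exists_ne_zero_of_dvd_charpoly [FiniteDimensional k W]
    (hf : f.Monic) (hT : T.charpoly = f) {q : k[X]}
    (hq : ¬ IsUnit q) (hqf : q ∣ f) : ∃ v : W, v ≠ 0 ∧ aeval T q v = 0 := by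
  have := hf.finite_adjoinRoot
  have := hf.free_adjoinRoot
  have hdet : LinearMap.det (aeval T q) = 0 := by
    rw [← norm_adjoinRoot hf T hT, Algebra.norm_apply]
    by_contra hne
    obtain ⟨r, hr⟩ := hqf
    have hr0 : AdjoinRoot.mk f r ≠ 0 := by
      rw [Ne, AdjoinRoot.mk_eq_zero]
      rintro ⟨s, hs⟩
      have hf0 := hf.ne_zero
      have : f * 1 = f * (q * s) := by
        rw [mul_one]
        conv_lhs => rw [hr, hs]
        ring
      exact hq (IsUnit.of_mul_eq_one s (mul_left_cancel₀ hf0 this).symm)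
    apply hr0
    apply (LinearMap.equivOfDetNeZero _ hne).injective
    change AdjoinRoot.mk f q * AdjoinRoot.mk f r = AdjoinRoot.mk f q * 0
    rw [← map_mul, ← hr, AdjoinRoot.mk_self, mul_zero]
  obtain ⟨v, hv, hv0⟩ := (Submodule.ne_bot_iff _).1 (LinearMap.bot_lt_ker_of_det_eq_zero hdet).ne'
  exact ⟨v, hv0, hv⟩

/-- An operator with separable characteristic polynomial `f` has a vector with annihilator `f`. -/
theorem exists_cyclic_vector [FiniteDimensional k W]
    (hf : f.Monic) (hsep : f.Separable) (hT : T.charpoly = f) :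
    ∃ v : W, ∀ p : k[X], aeval T p v = 0 → f ∣ p := by
  -- The divisor `h` of `f` is built up one irreducible factor `q` at a time. Separability keeps `q`
  -- coprime to the part already treated, so adding a nonzero vector of `ker q(T)` multiplies the
  -- annihilator by `q`.
  suffices H : ∀ h : k[X], h ∣ f → ∃ v : W, aeval T h v = 0 ∧
      ∀ p : k[X], aeval T p v = 0 → h ∣ p by
    obtain ⟨v, -, hv⟩ := H f dvd_rfl
    exact ⟨v, hv⟩
  intro h
  induction h using WfDvdMonoid.induction_on_irreducible with
  | zero => exact fun h0 => absurd (zero_dvd_iff.1 h0) hf.ne_zero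
  | unit u hu => exact fun _ => ⟨0, map_zero _, fun p _ => hu.dvd⟩
  | mul h' q hh' hq ih =>
    intro hdvd
    obtain ⟨v, hv, hv'⟩ := ih ((dvd_mul_left _ _).trans hdvd)
    obtain ⟨w, hw0, hw⟩ :=
      exists_ne_zero_of_dvd_charpoly hf hT hq.not_isUnit ((dvd_mul_right _ _).trans hdvd)
    have hco : IsCoprime q h' := (hsep.of_dvd hdvd).isCoprime
    refine ⟨v + w, ?_, fun p hp => hco.mul_dvd ?_ ?_⟩
    · rw [map_add, map_mul, Module.End.mul_apply, hv, map_zero, zero_add, ← map_mul, mul_comm,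
        map_mul, Module.End.mul_apply, hw, map_zero]
    · rw [map_add] at hp
      -- Applying `h'(T)` to `p(T)(v + w) = 0` removes `v`, so `h' p` kills `w`. So does `q`, and if
      -- `q ∤ p` these are coprime, forcing `w = 0`.
      by_contra hqp
      have hc : IsCoprime q (h' * p) := hco.mul_right (hq.coprime_iff_not_dvd.2 hqp)
      have h1 : aeval T (h' * p) w = 0 := by
        have := congrArg (aeval T h') hp
        rwa [map_add, ← Module.End.mul_apply, ← map_mul, mul_comm, map_mul, Module.End.mul_apply,
          hv, map_zero, zero_add, ← Module.End.mul_apply, ← map_mul, map_zero] at this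
      obtain ⟨a, b, hab⟩ := hc
      apply hw0
      have := congrArg (fun r => aeval T r w) hab
      rw [map_add, map_mul, map_mul, LinearMap.add_apply, Module.End.mul_apply,
        Module.End.mul_apply, hw, h1, map_zero, map_zero, add_zero, map_one,
        Module.End.one_apply] at this
      exact this.symm
    · rw [map_add] at hp
      refine hco.symm.dvd_of_dvd_mul_left (hv' (q * p) ?_)
      have := congrArg (aeval T q) hp
      rw [map_add, ← Module.End.mul_apply, ← Module.End.mul_apply, ← map_mul, mul_comm q p,
        map_mul, Module.End.mul_apply _ _ w, hw, map_zero, add_zero, map_zero] at this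
      rwa [mul_comm q p, map_mul]

theorem evalOp_root (hf : f.Monic) (hT : aeval T f = 0) :
    evalOp hf T (AdjoinRoot.root f) = T := by
  rw [← AdjoinRoot.mk_X, evalOp_mk hf hT, aeval_X]

theorem evalOp_one (hf : f.Monic) (hT : aeval T f = 0) : evalOp hf T 1 = 1 := by
  rw [← map_one (AdjoinRoot.mk f), evalOp_mk hf hT, map_one]

/-- `W` is isomorphic to `L = k[x]/(f)` as a `k[T]`-module. -/
theorem exists_equiv_adjoinRoot [FiniteDimensional k W]
    (hf : f.Monic) (hsep : f.Separable) (hT : T.charpoly = f) :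
    ∃ θ : AdjoinRoot f ≃ₗ[k] W, ∀ l, T (θ l) = θ (AdjoinRoot.root f * l) := by
  have := hf.finite_adjoinRoot
  obtain ⟨v, hv⟩ := exists_cyclic_vector hf hsep hT
  have hT0 := aeval_eq_zero hT
  let φ : AdjoinRoot f →ₗ[k] W :=
    LinearMap.applyₗ v ∘ₗ (aeval T).toLinearMap ∘ₗ AdjoinRoot.modByMonicHom hf
  have hφ : ∀ l, φ l = evalOp hf T l v := fun l => rfl
  have hinj : Function.Injective φ := by
    rw [injective_iff_map_eq_zero]
    intro l hl
    induction l using AdjoinRoot.induction_on with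
    | ih p =>
      rw [hφ, evalOp_mk hf hT0] at hl
      exact AdjoinRoot.mk_eq_zero.2 (hv p hl)
  have hfr : Module.finrank k (AdjoinRoot f) = Module.finrank k W := by
    rw [(AdjoinRoot.powerBasis' hf).finrank, AdjoinRoot.powerBasis'_dim, ← hT,
      LinearMap.charpoly_natDegree]
  refine ⟨LinearMap.linearEquivOfInjective φ hinj hfr, fun l => ?_⟩
  rw [LinearMap.linearEquivOfInjective_apply, LinearMap.linearEquivOfInjective_apply, hφ, hφ,
    evalOp_mul hf hT0, evalOp_root hf hT0, Module.End.mul_apply]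

theorem evalOp_apply_equiv (hf : f.Monic) (hT : aeval T f = 0) {θ : AdjoinRoot f ≃ₗ[k] W}
    (hθ : ∀ l, T (θ l) = θ (AdjoinRoot.root f * l)) (l m : AdjoinRoot f) :
    evalOp hf T l (θ m) = θ (l * m) := by
  induction l using AdjoinRoot.induction_on with
  | ih p =>
    rw [evalOp_mk hf hT]
    induction p using Polynomial.induction_on' with
    | add p q hp hq => rw [map_add, LinearMap.add_apply, hp, hq, map_add, add_mul, map_add]
    | monomial d a =>
      rw [← C_mul_X_pow_eq_monomial, map_mul, map_pow, aeval_X, aeval_C,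
        map_mul (AdjoinRoot.mk f), map_pow, AdjoinRoot.mk_X, Module.End.mul_apply,
        Module.algebraMap_end_apply, AdjoinRoot.mk_C,
        mul_assoc, ← AdjoinRoot.algebraMap_eq, ← Algebra.smul_def, map_smul]
      congr 1
      induction d with
      | zero => simp
      | succ d ih => rw [pow_succ', Module.End.mul_apply, ih, hθ, pow_succ', mul_assoc]

theorem evalOp_injective [FiniteDimensional k W]
    (hf : f.Monic) (hsep : f.Separable) (hT : T.charpoly = f) :
    Function.Injective (evalOp hf T) := by
  obtain ⟨θ, hθ⟩ := exists_equiv_adjoinRoot hf hsep hT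
  intro l m h
  have := congrArg (fun A => A (θ 1)) h
  simpa [evalOp_apply_equiv hf (aeval_eq_zero hT) hθ] using this

/-- The centralizer of `T` is `k[T]`. -/
theorem exists_evalOp_eq [FiniteDimensional k W]
    (hf : f.Monic) (hsep : f.Separable) (hT : T.charpoly = f)
    {A : Module.End k W} (hA : Commute A T) : ∃ l, A = evalOp hf T l := by
  obtain ⟨θ, hθ⟩ := exists_equiv_adjoinRoot hf hsep hT
  have hT0 := aeval_eq_zero hT
  -- An operator commuting with `T` is determined by its value on the cyclic vector `θ 1`.
  refine ⟨θ.symm (A (θ 1)), LinearMap.ext fun w => ?_⟩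
  obtain ⟨m, rfl⟩ := θ.surjective w
  have hc : Commute A (evalOp hf T m) := by
    obtain ⟨p, hp⟩ := AdjoinRoot.mk_surjective m
    rw [← hp, evalOp_mk hf hT0]
    induction p using Polynomial.induction_on' generalizing m with
    | add p q hp' hq' =>
      rw [map_add]
      exact (hp' _ rfl).add_right (hq' _ rfl)
    | monomial d a =>
      rw [aeval_monomial]
      exact (Algebra.commute_algebraMap_right a A).mul_right (hA.pow_right d)
  have h1 : θ m = evalOp hf T m (θ 1) := by rw [evalOp_apply_equiv hf hT0 hθ, mul_one]
  rw [evalOp_apply_equiv hf hT0 hθ, mul_comm, ← evalOp_apply_equiv hf hT0 hθ,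
    LinearEquiv.apply_symm_apply, h1, ← Module.End.mul_apply, hc.eq, Module.End.mul_apply]

/-- The inverse operator again commutes with `T`, hence is itself given by an element of `L`. -/
theorem isUnit_of_evalOp_isUnit [FiniteDimensional k W]
    (hf : f.Monic) (hsep : f.Separable) (hT : T.charpoly = f)
    {l : AdjoinRoot f} (hl : IsUnit (evalOp hf T l)) : IsUnit l := by
  have hT0 := aeval_eq_zero hT
  obtain ⟨u, hu⟩ := hl
  have hc : Commute ((u⁻¹ : (Module.End k W)ˣ) : Module.End k W) T := by
    have : Commute (u : Module.End k W) T := by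
      rw [hu]
      exact commute_of_mem_adjoin (evalOp_mem hf T l) (Algebra.subset_adjoin rfl)
    exact this.units_inv_left
  obtain ⟨m, hm⟩ := exists_evalOp_eq hf hsep hT hc
  refine IsUnit.of_mul_eq_one m (evalOp_injective hf hsep hT ?_)
  rw [evalOp_mul hf hT0, ← hu, ← hm, Units.mul_inv, evalOp_one hf hT0]

theorem det_evalOp [FiniteDimensional k W] (hf : f.Monic) (hT : T.charpoly = f) (l : AdjoinRoot f) :
    LinearMap.det (evalOp hf T l) = Algebra.norm k l := by
  obtain ⟨p, rfl⟩ := AdjoinRoot.mk_surjective l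
  rw [evalOp_mk hf (aeval_eq_zero hT), norm_adjoinRoot hf T hT]

theorem charpoly_lmul_root (hf : f.Monic) [Module.Finite k (AdjoinRoot f)] :
    (Algebra.lmul k (AdjoinRoot f) (AdjoinRoot.root f)).charpoly = f := by
  classical
  have := charpoly_leftMulMatrix (AdjoinRoot.powerBasis' hf)
  rw [Algebra.leftMulMatrix_apply] at this
  have h3 := LinearMap.charpoly_toMatrix (Algebra.lmul k (AdjoinRoot f) (AdjoinRoot.root f))
    (AdjoinRoot.powerBasis' hf).basis
  rw [← h3]
  refine this.trans ?_
  change minpoly k (AdjoinRoot.root f) = f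
  rw [AdjoinRoot.minpoly_root hf.ne_zero, hf.leadingCoeff]
  simp

theorem charpoly_of_equiv [FiniteDimensional k W] (hf : f.Monic) {θ : AdjoinRoot f ≃ₗ[k] W}
    (hθ : ∀ l, T (θ l) = θ (AdjoinRoot.root f * l)) : T.charpoly = f := by
  have := hf.finite_adjoinRoot
  have h : T = θ.conj (Algebra.lmul k (AdjoinRoot f) (AdjoinRoot.root f)) := by
    refine LinearMap.ext fun w => ?_
    obtain ⟨m, rfl⟩ := θ.surjective w
    rw [hθ, LinearEquiv.conj_apply]
    simp
  rw [h, LinearEquiv.charpoly_conj, charpoly_lmul_root hf]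

end Cyclic

/-! ## Galois descent for endomorphisms -/

section Descent

variable {k ks W : Type*} [Field k] [Field ks] [Algebra k ks] [AddCommGroup W] [Module k W]
  [FiniteDimensional k W]

/-- In a basis defined over `k`, the matrix entries of a Galois-fixed operator are Galois-fixed
scalars, hence lie in `k`. -/
theorem exists_baseChange_eq [IsGalois k ks] {g : Module.End ks (ks ⊗[k] W)}
    (hg : ∀ σ : ks ≃ₐ[k] ks, galEnd ks σ g = g) : ∃ u : Module.End k W, u.baseChange ks = g := by
  classical
  let b₀ := Module.finBasis k W
  let b := Algebra.TensorProduct.basis ks b₀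
  have hb : ∀ (τ : ks ≃ₐ[k] ks) i, τ • b i = b i := fun τ i => by
    simp [b, TensorProduct.smul_tmul']
  have hr : ∀ (σ : ks ≃ₐ[k] ks) (x : ks ⊗[k] W) i, b.repr (σ • x) i = σ (b.repr x i) :=
    fun σ x i => by
      conv_lhs => rw [← b.sum_repr x, Finset.smul_sum]
      simp only [smul_semilinear, hb]
      rw [b.repr_sum_self]
  have hfix : ∀ i j, ∃ c : k, algebraMap k ks c = b.repr (g (b j)) i := fun i j => by
    have : b.repr (g (b j)) i ∈ (⊥ : IntermediateField k ks) := by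
      rw [InfiniteGalois.mem_bot_iff_fixed]
      intro σ
      conv_rhs => rw [← hg σ, galEnd_apply, hb, hr]
    exact IntermediateField.mem_bot.1 this
  choose c hc using hfix
  refine ⟨b₀.constr k fun j => ∑ i, c i j • b₀ i, b.ext fun j => b.ext_elem fun i => ?_⟩
  rw [← hc i j]
  simp [b, Algebra.TensorProduct.basis_repr_tmul, Finsupp.single_apply]

end Descent

/-! ## Classification of split odd orthogonal spaces -/

section Split

variable {k V : Type*} [Field k] [AddCommGroup V] [Module k V] {B : LinearMap.BilinForm k V}

theorem linearIndependent_of_gram {ι : Type*} [Fintype ι] [DecidableEq ι] {v : ι → V}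
    (h : (Matrix.of fun i j => B (v i) (v j)).det ≠ 0) : LinearIndependent k v := by
  rw [Fintype.linearIndependent_iff]
  intro c hc
  refine congrFun (Matrix.eq_zero_of_vecMul_eq_zero h (funext fun j => ?_))
  have := congrArg (fun w => B w (v j)) hc
  simpa [Matrix.vecMul, dotProduct] using this

/-- The Gram matrix of the orthogonal sum of `n` hyperbolic planes and a line. -/
def splitGram (n : ℕ) (d : k) : Matrix ((Fin n ⊕ Fin n) ⊕ Unit) ((Fin n ⊕ Fin n) ⊕ Unit) k :=
  Matrix.fromBlocks (Matrix.fromBlocks 0 1 1 0) 0 0 (Matrix.of fun _ _ => d)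

theorem det_splitGram (n : ℕ) (d : k) : (splitGram n d).det = (-1) ^ n * d := by
  have h1 : (Matrix.fromBlocks 0 1 1 0 : Matrix (Fin n ⊕ Fin n) (Fin n ⊕ Fin n) k).det =
      (-1) ^ n := by
    -- A unipotent factor makes the upper left block invertible; the Schur complement is then `-1`,
    -- of determinant `(-1)ⁿ`.
    have h2 : (Matrix.fromBlocks 0 1 1 0 : Matrix (Fin n ⊕ Fin n) (Fin n ⊕ Fin n) k) *
        Matrix.fromBlocks 1 0 1 1 = Matrix.fromBlocks 1 1 1 0 := by
      rw [Matrix.fromBlocks_multiply]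
      simp
    have h3 := congrArg Matrix.det h2
    rw [Matrix.det_mul, Matrix.det_fromBlocks_zero₁₂, Matrix.det_fromBlocks_one₁₁] at h3
    simpa [Matrix.det_neg] using h3
  rw [splitGram, Matrix.det_fromBlocks_zero₂₁, h1]
  simp

variable {n : ℕ}

/-- Witt's completion of an isotropic family to hyperbolic planes, keeping an orthogonal line `e`
fixed. It is applied both to `W` and to `L`; comparing the resulting Gram matrices replaces an
appeal to Witt's theorem. -/
theorem exists_split_basis [FiniteDimensional k V]
    (h2 : (2 : k) ≠ 0) (hs : B.IsSymm) (hnd : B.Nondegenerate)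
    (hfr : Module.finrank k V = 2 * n + 1) {x : Fin n → V} (hx : LinearIndependent k x)
    (hxx : ∀ i j, B (x i) (x j) = 0) {e : V} (hex : ∀ i, B e (x i) = 0) {d : k} (hd : d ≠ 0)
    (he : B e e = d) :
    ∃ b : Module.Basis ((Fin n ⊕ Fin n) ⊕ Unit) k V, ∀ i j, B (b i) (b j) = splitGram n d i j := by
  classical
  have hxe : ∀ i, B (x i) e = 0 := fun i => by rw [hs.eq, hex]
  -- `y` represents, through the non-degenerate form, an extension to `V` of the `j`-th coordinate
  -- functional on the span of the `x i`.
  have hφ : ∀ j, ∃ y, ∀ i, B y (x i) = if i = j then 1 else 0 := fun j => by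
    obtain ⟨φ, hφ⟩ := LinearMap.exists_extend
      ((Module.Basis.span hx).coord j)
    refine ⟨(B.toDual hnd).symm φ, fun i => ?_⟩
    rw [LinearMap.BilinForm.apply_toDual_symm_apply]
    have := congrArg (fun ψ => ψ ((Module.Basis.span hx) i)) hφ
    simpa [Module.Basis.span_apply, Finsupp.single_apply] using this
  choose y hy using hφ
  have hy' : ∀ i j, B (x i) (y j) = if i = j then 1 else 0 := fun i j => by rw [hs.eq, hy]
  -- Projecting off `e` does not disturb the pairings with the `x i`, which are orthogonal to `e`.
  let z : Fin n → V := fun j => y j - (B (y j) e / d) • e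
  have hzx : ∀ i j, B (z j) (x i) = if i = j then 1 else 0 := fun i j => by simp [z, hy, hex]
  have hze : ∀ j, B (z j) e = 0 := fun j => by simp [z, he, hd]
  -- Half of the Gram matrix is removed from each side of `B (z i) (z j)`, so the corrected vectors
  -- are isotropic; this needs `2 ≠ 0`.
  let w : Fin n → V := fun j => z j - ∑ i, (B (z j) (z i) / 2) • x i
  have hwx : ∀ j i, B (w j) (x i) = if i = j then 1 else 0 := fun j i => by
    simp [w, hzx, hxx]
  have hwe : ∀ j, B (w j) e = 0 := fun j => by simp [w, hze, hxe]
  have hxz : ∀ i j, B (x i) (z j) = if i = j then 1 else 0 := fun i j => by rw [hs.eq, hzx]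
  have hww : ∀ i j, B (w i) (w j) = 0 := fun i j => by
    have h1 : B (w i) (w j) = B (w i) (z j) - ∑ l, (B (z j) (z l) / 2) * B (w i) (x l) := by
      simp only [w, map_sub, map_sum, map_smul, smul_eq_mul]
    have h3 : B (w i) (z j) = B (z i) (z j) - B (z i) (z j) / 2 := by
      simp [w, hxz]
    rw [h1, h3]
    simp only [hwx, mul_ite, mul_one, mul_zero, Finset.sum_ite_eq', Finset.mem_univ, if_true]
    rw [hs.eq (z j)]
    field_simp
    ring
  let v : (Fin n ⊕ Fin n) ⊕ Unit → V := Sum.elim (Sum.elim x w) fun _ => e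
  have hv : ∀ i j, B (v i) (v j) = splitGram n d i j := by
    rintro ((i | i) | i) ((j | j) | j)
    · simp [v, splitGram, hxx]
    · simp only [v, splitGram, Sum.elim_inl, Sum.elim_inr, Matrix.fromBlocks_apply₁₁,
        Matrix.fromBlocks_apply₁₂, Matrix.one_apply]
      rw [hs.eq, hwx]
    · simp [v, splitGram, hxe]
    · simp [v, splitGram, hwx, Matrix.one_apply, eq_comm]
    · simp [v, splitGram, hww]
    · simp [v, splitGram, hwe]
    · simp [v, splitGram, hex]
    · simp only [v, splitGram, Sum.elim_inl, Sum.elim_inr, Matrix.fromBlocks_apply₂₁,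
        Matrix.zero_apply]
      rw [hs.eq, hwe]
    · simp [v, splitGram, he]
  have hli : LinearIndependent k v := by
    refine linearIndependent_of_gram (B := B) ?_
    have : (Matrix.of fun i j => B (v i) (v j)) = splitGram n d := Matrix.ext hv
    rw [this, det_splitGram]
    exact mul_ne_zero (pow_ne_zero _ (neg_ne_zero.2 one_ne_zero)) hd
  refine ⟨basisOfLinearIndependentOfCardEqFinrank hli ?_, fun i j => ?_⟩
  · simp [hfr, two_mul]
  · rw [coe_basisOfLinearIndependentOfCardEqFinrank, hv]

theorem det_toMatrix_basis {ι ι' : Type*} [Fintype ι] [DecidableEq ι] [Fintype ι'] [DecidableEq ι']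
    (b : Module.Basis ι k V) (b' : Module.Basis ι' k V) : ∃ c : k, c ≠ 0 ∧
      (LinearMap.BilinForm.toMatrix b' B).det = (LinearMap.BilinForm.toMatrix b B).det * c ^ 2 := by
  let e := b'.indexEquiv b
  have h1 := LinearMap.BilinForm.toMatrix_mul_basis_toMatrix b (b'.reindex e) B
  have h3 : (LinearMap.BilinForm.toMatrix (b'.reindex e) B) =
      (LinearMap.BilinForm.toMatrix b' B).submatrix e.symm e.symm := by
    ext i j
    simp [LinearMap.BilinForm.toMatrix_apply]
  refine ⟨(b.toMatrix (b'.reindex e)).det, ?_, ?_⟩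
  · intro h
    have := congrArg Matrix.det (b.toMatrix_mul_toMatrix_flip (b'.reindex e))
    rw [Matrix.det_mul, h, zero_mul, Matrix.det_one] at this
    exact zero_ne_one this
  · rw [← Matrix.det_submatrix_equiv_self e.symm, ← h3, ← h1, Matrix.det_mul, Matrix.det_mul,
      Matrix.det_transpose]
    ring

/-- A split orthogonal space of determinant `(-1)ⁿ` has a basis with standard Gram matrix. -/
theorem IsSplitOrthogonal.exists_basis [FiniteDimensional k V]
    (h2 : (2 : k) ≠ 0) (hB : IsSplitOrthogonal n B) :
    ∃ b : Module.Basis ((Fin n ⊕ Fin n) ⊕ Unit) k V, ∀ i j, B (b i) (b j) = splitGram n 1 i j := by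
  obtain ⟨X, hX, hXX⟩ := hB.split
  have hrefl : B.IsRefl := hB.symm.isRefl
  -- If every vector of `X^⊥` were isotropic, polarization would give `X^⊥ ≤ (X^⊥)^⊥ = X`,
  -- impossible since the dimensions are `n + 1` and `n`.
  obtain ⟨e, he, hee⟩ : ∃ e ∈ B.orthogonal X, B e e ≠ 0 := by
    by_contra! H
    have h1 : B.orthogonal X ≤ X := by
      intro v hv
      rw [← LinearMap.BilinForm.orthogonal_orthogonal hB.nondegenerate hrefl X]
      rw [LinearMap.BilinForm.mem_orthogonal_iff]
      intro w hw
      have h3 := H (v + w) (add_mem hv hw)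
      simp only [map_add, LinearMap.add_apply, H v hv, H w hw, hB.symm.eq v w, zero_add,
        add_zero, ← two_mul] at h3
      exact (mul_eq_zero.1 h3).resolve_left h2
    have h3 := LinearMap.BilinForm.finrank_orthogonal hB.nondegenerate X
    have h4 := Submodule.finrank_mono h1
    rw [h3, hB.finrank, hX] at h4
    omega
  let x := Module.finBasisOfFinrankEq k X hX
  have hx : LinearIndependent k fun i => (x i : V) :=
    x.linearIndependent.map' X.subtype (Submodule.ker_subtype X)
  have hxx : ∀ i j, B (x i : V) (x j) = 0 := fun i j => hXX _ (x i).2 _ (x j).2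
  have hex : ∀ i, B e (x i) = 0 := fun i => by
    rw [hB.symm.eq]
    exact he _ (x i).2
  -- This first basis serves only to compare determinants: they show that `B e e` is a square, after
  -- which `e` is rescaled to a unit vector and the construction is repeated.
  obtain ⟨b, hb⟩ := exists_split_basis h2 hB.symm hB.nondegenerate hB.finrank hx hxx hex hee rfl
  obtain ⟨b', c, hc, hdet⟩ := hB.det
  obtain ⟨s, hs, hdet'⟩ := det_toMatrix_basis (B := B) b' b
  have hG : LinearMap.BilinForm.toMatrix b B = splitGram n (B e e) := by
    ext i j
    rw [LinearMap.BilinForm.toMatrix_apply, hb]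
  rw [hG, det_splitGram, hdet, mul_assoc] at hdet'
  have hd : B e e = (c * s) ^ 2 := by
    rw [mul_pow]
    exact mul_left_cancel₀ (pow_ne_zero _ (neg_ne_zero.2 one_ne_zero)) hdet'
  refine exists_split_basis h2 hB.symm hB.nondegenerate hB.finrank hx hxx
    (e := (c * s)⁻¹ • e) (fun i => ?_) one_ne_zero ?_
  · simp [hex]
  · have := mul_ne_zero hc hs
    simp only [map_smul, LinearMap.smul_apply, smul_eq_mul, hd]
    field_simp

theorem exists_isometry {V' : Type*} [AddCommGroup V'] [Module k V'] {B' : LinearMap.BilinForm k V'}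
    {ι : Type*} (G : Matrix ι ι k) (b : Module.Basis ι k V) (b' : Module.Basis ι k V')
    (hb : ∀ i j, B (b i) (b j) = G i j) (hb' : ∀ i j, B' (b' i) (b' j) = G i j) :
    ∃ θ : V ≃ₗ[k] V', ∀ v w, B' (θ v) (θ w) = B v w := by
  let θ := b.equiv b' (Equiv.refl ι)
  have h : B'.comp θ.toLinearMap θ.toLinearMap = B := by
    refine b.ext fun i => b.ext fun j => ?_
    simp [θ, hb, hb']
  exact ⟨θ, fun v w => by rw [← h]; rfl⟩

end Split

/-! ## Isometries and orbits -/

section Orbit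

variable {R M : Type*} [Field R] [AddCommGroup M] [Module R M]
  {B : LinearMap.BilinForm R M}

/-- Take determinants in `Uᵀ G U = Aᵀ G`, with `G` the Gram matrix. With `A = 1` it shows that
isometries have determinant `±1`; for general `A` it is the source of the square-norm condition on
`α`. -/
theorem det_sq_eq_det [FiniteDimensional R M] (hB : B.Nondegenerate) {u A : Module.End R M}
    (H : ∀ v w, B (u v) (u w) = B (A v) w) : LinearMap.det u ^ 2 = LinearMap.det A := by
  classical
  let b := Module.finBasis R M
  let G := LinearMap.BilinForm.toMatrix b B
  have hdet : G.det ≠ 0 := (LinearMap.BilinForm.nondegenerate_iff_det_ne_zero b).1 hB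
  have e1 : (LinearMap.toMatrix b b u).transpose * G * LinearMap.toMatrix b b u =
      (LinearMap.toMatrix b b A).transpose * G := by
    rw [← LinearMap.BilinForm.toMatrix_comp b b B u u, ← LinearMap.BilinForm.toMatrix_compLeft]
    congr 1
    exact LinearMap.ext fun v => LinearMap.ext fun w => H v w
  have e2 := congrArg Matrix.det e1
  simp only [Matrix.det_mul, Matrix.det_transpose, LinearMap.det_toMatrix] at e2
  refine mul_right_cancel₀ hdet ?_
  rw [← e2]
  ring

/-- The scalar operators. -/
def scalarGL (R M : Type*) [Field R] [AddCommGroup M] [Module R M] :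
    Rˣ →* LinearMap.GeneralLinearGroup R M :=
  Units.map (algebraMap R (Module.End R M)).toMonoidHom

/-- Scalars are central, so the sign used to move an isometry into `SO` does not affect conjugation.
-/
theorem scalarGL_mul_conj (e : Rˣ) (u : LinearMap.GeneralLinearGroup R M) (T : Module.End R M) :
    ((scalarGL R M e * u : LinearMap.GeneralLinearGroup R M) : Module.End R M) * T *
      ((scalarGL R M e * u)⁻¹ : LinearMap.GeneralLinearGroup R M) =
      u * T * (u⁻¹ : LinearMap.GeneralLinearGroup R M) := by
  have h : Commute ((scalarGL R M e : LinearMap.GeneralLinearGroup R M) : Module.End R M)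
      (u * T * (u⁻¹ : LinearMap.GeneralLinearGroup R M)) := Algebra.commutes _ _
  rw [mul_inv_rev, Units.val_mul, Units.val_mul, mul_assoc _ (u : Module.End R M), ← mul_assoc,
    mul_assoc _ _ ((u⁻¹ : LinearMap.GeneralLinearGroup R M) : Module.End R M), h.eq,
    Units.mul_inv_cancel_right]

/-- In odd dimension an isometry is, up to sign, in the special orthogonal group. -/
theorem exists_mem_SO_of_isometry (hodd : Odd (Module.finrank R M))
    {u : LinearMap.GeneralLinearGroup R M}
    (hu : ∀ v w, B ((u : Module.End R M) v) ((u : Module.End R M) w) = B v w)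
    (hdet : LinearMap.det (u : Module.End R M) ^ 2 = 1) :
    ∃ e : Rˣ, (e = 1 ∨ e = -1) ∧ scalarGL R M e * u ∈ SO B := by
  rcases sq_eq_one_iff.1 hdet with h | h
  · exact ⟨1, Or.inl rfl, by rw [map_one, one_mul]; exact ⟨hu, h⟩⟩
  · have hval : ((scalarGL R M (-1) * u : LinearMap.GeneralLinearGroup R M) : Module.End R M) =
        (-1 : R) • (u : Module.End R M) := by
      rw [Algebra.smul_def]
      rfl
    refine ⟨-1, Or.inr rfl, fun v w => ?_, ?_⟩
    · simp [hval, hu]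
    · rw [hval, LinearMap.det_smul, h, hodd.neg_one_pow]
      simp

/-- In odd dimension the full orthogonal group is `SO` times `±1`, so its orbits of operators are
those of `SO`. -/
theorem mem_orbit_of_isometry [FiniteDimensional R M]
    (hodd : Odd (Module.finrank R M)) (hB : B.Nondegenerate)
    {T S : Module.End R M} {u : LinearMap.GeneralLinearGroup R M}
    (hu : ∀ v w, B ((u : Module.End R M) v) ((u : Module.End R M) w) = B v w)
    (hS : S * u = u * T) : S ∈ orbit B T := by
  have hdet := det_sq_eq_det hB (A := 1) hu
  rw [map_one] at hdet
  obtain ⟨e, -, h⟩ := exists_mem_SO_of_isometry hodd hu hdet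
  exact ⟨_, h, by rw [scalarGL_mul_conj]; exact (Units.eq_mul_inv_iff_mul_eq u).2 hS⟩

theorem mem_orbit_self (T : Module.End R M) : T ∈ orbit B T := ⟨1, one_mem _, by simp⟩

theorem orbit_eq_of_mem {T S : Module.End R M} (h : S ∈ orbit B T) : orbit B S = orbit B T := by
  obtain ⟨g, hg, rfl⟩ := h
  ext X
  constructor
  · rintro ⟨x, hx, rfl⟩
    exact ⟨x * g, mul_mem hx hg, by simp [mul_assoc]⟩
  · rintro ⟨x, hx, rfl⟩
    exact ⟨x * g⁻¹, mul_mem hx (inv_mem hg), by simp [mul_assoc]⟩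

end Orbit

/-! ## The distinguished operators -/

section Distinguished

variable {k : Type*} [Field k] {f : k[X]} {n : ℕ}

/-- The form `⟨λ, μ⟩ =` the coefficient of `x²ⁿ` in `sⁿ λ μ^τ` on `L = k[x]/(f)`. -/
def coeffForm (n : ℕ) (hf : f.Monic) (s : k) (τ : AdjoinRoot f →ₐ[k] AdjoinRoot f) :
    LinearMap.BilinForm k (AdjoinRoot f) :=
  s ^ n • ((LinearMap.mul k (AdjoinRoot f)).compl₂ τ.toLinearMap).compr₂
    (lcoeff k (2 * n) ∘ₗ AdjoinRoot.modByMonicHom hf)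

theorem coeffForm_apply (hf : f.Monic) (s : k) (τ : AdjoinRoot f →ₐ[k] AdjoinRoot f)
    (l m : AdjoinRoot f) : coeffForm n hf s τ l m =
      s ^ n * (AdjoinRoot.modByMonicHom hf (l * τ m)).coeff (2 * n) := rfl

theorem modByMonicHom_mk_of_degree_lt (hf : f.Monic) {p : k[X]} (hp : p.degree < f.degree) :
    AdjoinRoot.modByMonicHom hf (AdjoinRoot.mk f p) = p := by
  rw [AdjoinRoot.modByMonicHom_mk, modByMonic_eq_self_iff hf]
  exact hp

theorem exists_mk_eq (hf : f.Monic) (l : AdjoinRoot f) :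
    ∃ p : k[X], p.degree < f.degree ∧ l = AdjoinRoot.mk f p := by
  obtain ⟨p, rfl⟩ := AdjoinRoot.mk_surjective l
  exact ⟨p %ₘ f, degree_modByMonic_lt p hf, (AdjoinRoot.mk_eq_mk.2
    ⟨p /ₘ f, by rw [sub_eq_iff_eq_add]; conv_lhs => rw [← modByMonic_add_div p f, add_comm]⟩)⟩

variable {s : k} {τ : AdjoinRoot f →ₐ[k] AdjoinRoot f}

/-- A parameter `s` with `s * s = 1` treats both parts at once: `τ` is the substitution `x ↦ s x`,
which is the involution of `L` for `s = -1` and the identity for `s = 1`. -/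
theorem algHom_mk (hτ : τ (AdjoinRoot.root f) = AdjoinRoot.mk f (C s * X)) (p : k[X]) :
    τ (AdjoinRoot.mk f p) = AdjoinRoot.mk f (p.comp (C s * X)) := by
  rw [← AdjoinRoot.aeval_eq, ← aeval_algHom_apply, hτ, ← AdjoinRoot.aeval_eq, ← aeval_comp,
    AdjoinRoot.aeval_eq]

theorem algHom_involutive (hs : s * s = 1)
    (hτ : τ (AdjoinRoot.root f) = AdjoinRoot.mk f (C s * X)) (l : AdjoinRoot f) : τ (τ l) = l := by
  obtain ⟨p, rfl⟩ := AdjoinRoot.mk_surjective l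
  rw [algHom_mk hτ, algHom_mk hτ, comp_assoc]
  congr 1
  simp [← mul_assoc, ← C_mul, hs]

/-- Exchanging the arguments applies `τ` to `l * τ m`. The substitution `x ↦ s x` keeps a reduced
representative reduced and multiplies its coefficient of `x²ⁿ` by `s²ⁿ = 1`; the even degree matters
here. -/
theorem coeffForm_isSymm (hf : f.Monic) (hs : s * s = 1)
    (hτ : τ (AdjoinRoot.root f) = AdjoinRoot.mk f (C s * X)) :
    (coeffForm n hf s τ).IsSymm := by
  refine ⟨fun l m => ?_⟩
  rw [coeffForm_apply, coeffForm_apply]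
  congr 1
  have h : m * τ l = τ (l * τ m) := by rw [map_mul, algHom_involutive hs hτ, mul_comm]
  rw [h]
  obtain ⟨p, hp, hp'⟩ := exists_mk_eq hf (l * τ m)
  have hs0 : s ≠ 0 := left_ne_zero_of_mul_eq_one hs
  have hdp : (p.comp (C s * X)).degree < f.degree := by
    refine lt_of_le_of_lt ?_ hp
    rw [degree_le_iff_coeff_zero]
    intro d hd
    rw [comp_C_mul_X_coeff, coeff_eq_zero_of_degree_lt hd, zero_mul]
  rw [hp', algHom_mk hτ, modByMonicHom_mk_of_degree_lt hf hp,
    modByMonicHom_mk_of_degree_lt hf hdp, comp_C_mul_X_coeff, pow_mul, sq, hs, one_pow, mul_one]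

theorem coeff_modByMonicHom_root_pow (hf : f.Monic) (hdeg : f.natDegree = 2 * n + 1) {d : ℕ}
    (hd : d ≤ 2 * n) :
    (AdjoinRoot.modByMonicHom hf (AdjoinRoot.root f ^ d)).coeff (2 * n) =
      if d = 2 * n then 1 else 0 := by
  have : (X ^ d : k[X]).degree < f.degree := by
    rw [degree_X_pow, degree_eq_natDegree hf.ne_zero, hdeg]
    exact_mod_cast Nat.lt_succ_of_le hd
  rw [← AdjoinRoot.mk_X, ← map_pow, modByMonicHom_mk_of_degree_lt hf this, coeff_X_pow]
  simp [eq_comm]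

/-- Up to total degree `2n` no reduction modulo `f` occurs, so these pairings do not depend on the
lower coefficients of `f`. -/
theorem coeffForm_root_pow (hf : f.Monic) (hdeg : f.natDegree = 2 * n + 1)
    (hτ : τ (AdjoinRoot.root f) = AdjoinRoot.mk f (C s * X)) {i j : ℕ} (hij : i + j ≤ 2 * n) :
    coeffForm n hf s τ (AdjoinRoot.root f ^ i) (AdjoinRoot.root f ^ j) =
      if i + j = 2 * n then s ^ (n + j) else 0 := by
  have h : AdjoinRoot.root f ^ i * τ (AdjoinRoot.root f ^ j) =
      s ^ j • AdjoinRoot.root f ^ (i + j) := by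
    rw [map_pow, hτ, map_mul, AdjoinRoot.mk_C, AdjoinRoot.mk_X, Algebra.smul_def, map_pow,
      AdjoinRoot.algebraMap_eq]
    ring
  rw [coeffForm_apply, h, map_smul, coeff_smul, coeff_modByMonicHom_root_pow hf hdeg hij, pow_add]
  split_ifs <;> simp

theorem coeffForm_nondegenerate (hf : f.Monic) (hdeg : f.natDegree = 2 * n + 1) (hs : s * s = 1)
    (hτ : τ (AdjoinRoot.root f) = AdjoinRoot.mk f (C s * X)) :
    (coeffForm n hf s τ).Nondegenerate := by
  have hsymm := coeffForm_isSymm (n := n) hf hs hτ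
  have hs0 : s ≠ 0 := left_ne_zero_of_mul_eq_one hs
  have key : ∀ l, (∀ m, coeffForm n hf s τ l m = 0) → l = 0 := by
    intro l hl
    obtain ⟨p, hp, rfl⟩ := exists_mk_eq hf l
    by_contra hp0
    have hp1 : p ≠ 0 := fun h => hp0 (by rw [h, map_zero])
    have hd : p.natDegree ≤ 2 * n := by
      have := natDegree_lt_natDegree hp1 hp
      omega
    -- The exponent brings the product with `p` to degree exactly `2n`, still below `deg f`, so the
    -- pairing is the leading coefficient of `p` up to a power of `s`.
    have h := hl (AdjoinRoot.root f ^ (2 * n - p.natDegree))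
    have hm : ∀ e, AdjoinRoot.mk f p * τ (AdjoinRoot.root f ^ e) =
        s ^ e • AdjoinRoot.mk f (p * X ^ e) := fun e => by
      rw [map_pow, hτ, map_mul, map_mul, map_pow, AdjoinRoot.mk_C, AdjoinRoot.mk_X,
        Algebra.smul_def, map_pow, AdjoinRoot.algebraMap_eq]
      ring
    rw [coeffForm_apply, hm, map_smul, coeff_smul, modByMonicHom_mk_of_degree_lt hf,
      smul_eq_mul] at h
    · have h3 : (p * X ^ (2 * n - p.natDegree)).coeff (2 * n) = p.leadingCoeff := by
        conv_lhs => rw [show 2 * n = p.natDegree + (2 * n - p.natDegree) by omega]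
        rw [show p.natDegree + (2 * n - p.natDegree) - p.natDegree = 2 * n - p.natDegree by omega,
          coeff_mul_X_pow, leadingCoeff]
      rw [h3] at h
      exact mul_ne_zero (pow_ne_zero _ hs0)
        (mul_ne_zero (pow_ne_zero _ hs0) (leadingCoeff_ne_zero.2 hp1)) h
    · rw [degree_mul, degree_X_pow, degree_eq_natDegree hp1, degree_eq_natDegree hf.ne_zero, hdeg]
      exact_mod_cast (by omega : p.natDegree + (2 * n - p.natDegree) < 2 * n + 1)
  exact ⟨key, fun m hm => key m fun l => by rw [hsymm.eq]; exact hm l⟩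

variable {W : Type*} [AddCommGroup W] [Module k W]
  {B : LinearMap.BilinForm k W}

/-- `L` with the form `coeffForm` is isometric to any split space of determinant `(-1)ⁿ`. -/
theorem exists_coeffForm_isometry [FiniteDimensional k W]
    (h2 : (2 : k) ≠ 0) (hB : IsSplitOrthogonal n B) (hf : f.Monic)
    (hdeg : f.natDegree = 2 * n + 1) (hs : s * s = 1)
    (hτ : τ (AdjoinRoot.root f) = AdjoinRoot.mk f (C s * X)) :
    ∃ θ : AdjoinRoot f ≃ₗ[k] W, ∀ l m, B (θ l) (θ m) = coeffForm n hf s τ l m := by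
  have := hf.finite_adjoinRoot
  obtain ⟨b', hb'⟩ := hB.exists_basis h2
  let pb := AdjoinRoot.powerBasis' hf
  have hfr : Module.finrank k (AdjoinRoot f) = 2 * n + 1 := by
    rw [pb.finrank, AdjoinRoot.powerBasis'_dim, hdeg]
  have hx : LinearIndependent k fun i : Fin n => AdjoinRoot.root f ^ (i : ℕ) := by
    have h1 := pb.basis.linearIndependent
    rw [pb.coe_basis] at h1
    exact h1.comp (fun i : Fin n => ⟨i, by
      rw [AdjoinRoot.powerBasis'_dim, hdeg]; omega⟩) fun i j h => by
        simpa [Fin.ext_iff] using h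
  -- The powers `1, …, xⁿ⁻¹` are isotropic and orthogonal to `xⁿ`, since their exponents add up to
  -- less than `2n`. The factor `sⁿ` in the form makes `⟨xⁿ, xⁿ⟩ = s²ⁿ = 1`.
  obtain ⟨b, hb⟩ := exists_split_basis h2 (coeffForm_isSymm (n := n) hf hs hτ)
    (coeffForm_nondegenerate hf hdeg hs hτ) hfr hx
    (fun i j => by
      rw [coeffForm_root_pow hf hdeg hτ (by omega), if_neg (by omega)])
    (e := AdjoinRoot.root f ^ n)
    (fun i => by
      rw [coeffForm_root_pow hf hdeg hτ (by omega), if_neg (by omega)])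
    one_ne_zero (by
      rw [coeffForm_root_pow hf hdeg hτ (by omega), if_pos (by omega), ← two_mul, pow_mul, sq, hs,
        one_pow])
  exact exists_isometry _ b b' hb hb'

theorem adjoint_of_coeffForm (hf : f.Monic) (hs : s * s = 1)
    (hτ : τ (AdjoinRoot.root f) = AdjoinRoot.mk f (C s * X)) {T : Module.End k W}
    {θ : AdjoinRoot f ≃ₗ[k] W} (hθ : ∀ l m, B (θ l) (θ m) = coeffForm n hf s τ l m)
    (hT : ∀ l, T (θ l) = θ (AdjoinRoot.root f * l)) (v w : W) : B (T v) w = s * B v (T w) := by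
  obtain ⟨l, rfl⟩ := θ.surjective v
  obtain ⟨m, rfl⟩ := θ.surjective w
  have h : l * τ (AdjoinRoot.root f * m) = s • (AdjoinRoot.root f * l * τ m) := by
    rw [map_mul, hτ, map_mul, AdjoinRoot.mk_C, AdjoinRoot.mk_X, Algebra.smul_def,
      AdjoinRoot.algebraMap_eq]
    ring
  rw [hT, hT, hθ, hθ, coeffForm_apply, coeffForm_apply, h, map_smul, coeff_smul, smul_eq_mul,
    mul_left_comm s, ← mul_assoc s, hs, one_mul]

/-- The distinguished operators form a single orbit. -/
theorem orbit_eq_of_coeffForm [FiniteDimensional k W]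
    (hB : IsSplitOrthogonal n B) (hf : f.Monic) {T : Module.End k W}
    {θ : AdjoinRoot f ≃ₗ[k] W} (hθ : ∀ l m, B (θ l) (θ m) = coeffForm n hf s τ l m)
    (hT : ∀ l, T (θ l) = θ (AdjoinRoot.root f * l)) :
    {S | ∃ θ : AdjoinRoot f ≃ₗ[k] W, (∀ l m, B (θ l) (θ m) = coeffForm n hf s τ l m) ∧
      ∀ l, S (θ l) = θ (AdjoinRoot.root f * l)} = orbit B T := by
  have hodd : Odd (Module.finrank k W) := ⟨n, hB.finrank⟩
  ext S
  constructor
  · rintro ⟨θ', hθ', hS⟩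
    refine mem_orbit_of_isometry hodd hB.nondegenerate
      (u := LinearMap.GeneralLinearGroup.ofLinearEquiv (θ.symm.trans θ')) (fun v w => ?_)
      (LinearMap.ext fun v => ?_)
    · change B (θ' (θ.symm v)) (θ' (θ.symm w)) = _
      rw [hθ', ← hθ, θ.apply_symm_apply, θ.apply_symm_apply]
    · obtain ⟨l, rfl⟩ := θ.surjective v
      change S (θ' (θ.symm (θ l))) = θ' (θ.symm (T (θ l)))
      rw [hT, θ.symm_apply_apply, θ.symm_apply_apply, hS]
  · rintro ⟨g, hg, rfl⟩
    refine ⟨θ.trans (LinearMap.GeneralLinearGroup.toLinearEquiv g), fun l m => ?_, fun l => ?_⟩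
    · rw [← hθ]
      exact hg.1 _ _
    · change ((g : Module.End k W) * T * (g⁻¹ : LinearMap.GeneralLinearGroup k W) * g) (θ l) =
        (g : Module.End k W) (θ (AdjoinRoot.root f * l))
      rw [Units.inv_mul_cancel_right, Module.End.mul_apply, hT]

theorem exists_distinguished [FiniteDimensional k W]
    (h2 : (2 : k) ≠ 0) (hB : IsSplitOrthogonal n B) (hf : f.Monic)
    (hdeg : f.natDegree = 2 * n + 1) (hs : s * s = 1)
    (hτ : τ (AdjoinRoot.root f) = AdjoinRoot.mk f (C s * X)) :
    ∃ T : Module.End k W, (∀ v w, B (T v) w = s * B v (T w)) ∧ T.charpoly = f ∧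
      {S | ∃ θ : AdjoinRoot f ≃ₗ[k] W, (∀ l m, B (θ l) (θ m) = coeffForm n hf s τ l m) ∧
        ∀ l, S (θ l) = θ (AdjoinRoot.root f * l)} = orbit B T := by
  obtain ⟨θ, hθ⟩ := exists_coeffForm_isometry h2 hB hf hdeg hs hτ
  have hT : ∀ l, θ.conj (LinearMap.mul k _ (AdjoinRoot.root f)) (θ l) =
      θ (AdjoinRoot.root f * l) := fun l => by simp [LinearEquiv.conj_apply]
  exact ⟨_, adjoint_of_coeffForm hf hs hτ hθ hT, charpoly_of_equiv hf hT,
    orbit_eq_of_coeffForm hB hf hθ hT⟩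

end Distinguished

/-! ## Operators and twisted forms -/

section Twist

variable {k W : Type*} [Field k] [AddCommGroup W] [Module k W]
  {B : LinearMap.BilinForm k W} {T S A : Module.End k W} {s : k}

/-- `S = u T u⁻¹` for a `k`-linear `u` which carries the form `⟨A v, w⟩` to the form of `W`. -/
def IsTwist (B : LinearMap.BilinForm k W) (T A S : Module.End k W) : Prop :=
  ∃ u : LinearMap.GeneralLinearGroup k W, S * u = u * T ∧
    ∀ v w, B ((u : Module.End k W) v) ((u : Module.End k W) w) = B (A v) w

theorem inv_mul_eq_of_mul_eq {u : LinearMap.GeneralLinearGroup k W} (hu : S * u = u * T) :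
    ((u⁻¹ : LinearMap.GeneralLinearGroup k W) : Module.End k W) * S =
      T * (u⁻¹ : LinearMap.GeneralLinearGroup k W) := by
  rw [Units.inv_mul_eq_iff_eq_mul, ← mul_assoc, ← hu, Units.mul_inv_cancel_right]

/-- Since `A` commutes with `T`, the adjointness of `T` also holds for the form `⟨A v, w⟩`, which
`u` transports to the form of `W` and `T` to `S`. -/
theorem IsTwist.adjoint (hS : IsTwist B T A S) (hT : ∀ v w, B (T v) w = s * B v (T w))
    (hA : Commute A T) (v w : W) : B (S v) w = s * B v (S w) := by
  obtain ⟨u, hu, hB⟩ := hS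
  obtain ⟨v, rfl⟩ : ∃ x, (u : Module.End k W) x = v := ⟨_, mul_inv_apply' u v⟩
  obtain ⟨w, rfl⟩ : ∃ x, (u : Module.End k W) x = w := ⟨_, mul_inv_apply' u w⟩
  rw [← Module.End.mul_apply, ← Module.End.mul_apply, hu, Module.End.mul_apply,
    Module.End.mul_apply, hB, hB, ← Module.End.mul_apply, hA.eq, Module.End.mul_apply, hT]

theorem charpoly_eq_of_mul_eq [FiniteDimensional k W] {u : LinearMap.GeneralLinearGroup k W}
    (hu : S * u = u * T) : S.charpoly = T.charpoly := by
  rw [← LinearEquiv.charpoly_conj (LinearMap.GeneralLinearGroup.toLinearEquiv u) T]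
  congr 1
  rw [(Units.eq_mul_inv_iff_mul_eq u).2 hu]
  rfl

theorem IsTwist.charpoly [FiniteDimensional k W] (hS : IsTwist B T A S) :
    S.charpoly = T.charpoly := by
  obtain ⟨u, hu, -⟩ := hS
  exact charpoly_eq_of_mul_eq hu

theorem isTwist_one : IsTwist B T 1 T := ⟨1, by simp, fun _ _ => rfl⟩

/-- Twisting by a form isometric to `⟨A v, w⟩` through an operator commuting with `T`. -/
theorem IsTwist.trans {A' : Module.End k W} (hS : IsTwist B T A S)
    {l : LinearMap.GeneralLinearGroup k W} (hl : Commute (l : Module.End k W) T)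
    (hA : ∀ v w, B (A' v) w = B (A ((l : Module.End k W) v)) ((l : Module.End k W) w)) :
    IsTwist B T A' S := by
  obtain ⟨u, hu, hB⟩ := hS
  refine ⟨u * l, ?_, fun v w => ?_⟩
  · rw [Units.val_mul, ← mul_assoc, hu, mul_assoc, ← hl.eq, mul_assoc]
  · rw [Units.val_mul, Module.End.mul_apply, Module.End.mul_apply, hB, hA]

theorem IsTwist.of_mem_orbit {S' : Module.End k W} (hS : IsTwist B T A S)
    (h : S' ∈ orbit B S) : IsTwist B T A S' := by
  obtain ⟨u, hu, hB⟩ := hS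
  obtain ⟨g, hg, rfl⟩ := h
  refine ⟨g * u, ?_, fun v w => ?_⟩
  · rw [Units.val_mul, ← mul_assoc, Units.inv_mul_cancel_right, mul_assoc, hu, mul_assoc]
  · rw [Units.val_mul, Module.End.mul_apply, Module.End.mul_apply, hg.1, hB]

/-- The two intertwining maps pull `B` back to the same form, so `u' u⁻¹` is an isometry conjugating
`S` to `S'`. -/
theorem IsTwist.mem_orbit [FiniteDimensional k W] (hodd : Odd (Module.finrank k W))
    (hB : B.Nondegenerate) {S' : Module.End k W} (hS : IsTwist B T A S) (hS' : IsTwist B T A S') :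
    S' ∈ orbit B S := by
  obtain ⟨u, hu, huA⟩ := hS
  obtain ⟨u', hu', huA'⟩ := hS'
  refine mem_orbit_of_isometry hodd hB (u := u' * u⁻¹) (fun v w => ?_) ?_
  · rw [Units.val_mul, Module.End.mul_apply, Module.End.mul_apply, huA', ← huA, mul_inv_apply',
      mul_inv_apply']
  · rw [Units.val_mul, ← mul_assoc, hu', mul_assoc, mul_assoc, inv_mul_eq_of_mul_eq hu]

/-- Two twists of the same operator differ by an operator commuting with `T`. -/
theorem IsTwist.exists_commute {A' : Module.End k W} (hS : IsTwist B T A S)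
    (hS' : IsTwist B T A' S) : ∃ l : LinearMap.GeneralLinearGroup k W,
      Commute (l : Module.End k W) T ∧
        ∀ v w, B (A' v) w = B (A ((l : Module.End k W) v)) ((l : Module.End k W) w) := by
  obtain ⟨u, hu, huA⟩ := hS
  obtain ⟨u', hu', huA'⟩ := hS'
  refine ⟨u⁻¹ * u', ?_, fun v w => ?_⟩
  · change _ * _ = _ * _
    rw [Units.val_mul, mul_assoc, ← hu', ← mul_assoc, inv_mul_eq_of_mul_eq hu, mul_assoc]
  · rw [← huA', ← huA, Units.val_mul, Module.End.mul_apply, Module.End.mul_apply, mul_inv_apply',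
      mul_inv_apply']

/-- Every operator of the same type as `T` is a twist of `T`. -/
theorem exists_isTwist [FiniteDimensional k W] (hs : B.IsSymm) (hnd : B.Nondegenerate) {f : k[X]}
    (hf : f.Monic) (hsep : f.Separable) (hTf : T.charpoly = f) (hSf : S.charpoly = f)
    (hT : ∀ v w, B (T v) w = s * B v (T w)) (hS : ∀ v w, B (S v) w = s * B v (S w)) :
    ∃ l : AdjoinRoot f, IsUnit l ∧ (∀ v w, B (evalOp hf T l v) w = B v (evalOp hf T l w)) ∧
      (∃ c : k, c ≠ 0 ∧ Algebra.norm k l = c ^ 2) ∧ IsTwist B T (evalOp hf T l) S := by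
  obtain ⟨θ, hθ⟩ := exists_equiv_adjoinRoot hf hsep hTf
  obtain ⟨θ', hθ'⟩ := exists_equiv_adjoinRoot hf hsep hSf
  let u : LinearMap.GeneralLinearGroup k W :=
    LinearMap.GeneralLinearGroup.ofLinearEquiv (θ.symm.trans θ')
  have huT : S * u = u * T := LinearMap.ext fun v => by
    obtain ⟨l, rfl⟩ := θ.surjective v
    change S (θ' (θ.symm (θ l))) = θ' (θ.symm (T (θ l)))
    rw [hθ, θ.symm_apply_apply, θ.symm_apply_apply, hθ']
  -- `A` represents the form pulled back along `u` with respect to the non-degenerate form `B`.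
  let A : Module.End k W := LinearMap.BilinForm.symmCompOfNondegenerate
    (B.comp (u : Module.End k W) (u : Module.End k W)) B hnd
  have hA : ∀ v w, B ((u : Module.End k W) v) ((u : Module.End k W) w) = B (A v) w := fun v w =>
    (LinearMap.BilinForm.symmCompOfNondegenerate_left_apply
      (B.comp (u : Module.End k W) (u : Module.End k W)) hnd w v).symm
  -- Both `S` and `T` move across the form with the same sign `s`; passing `T v` through `u`, then
  -- `S`, then back gives `⟨A T v, w⟩ = s ⟨A v, T w⟩ = ⟨T A v, w⟩`.
  have hAT : Commute A T := LinearMap.ext fun v => by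
    refine sub_eq_zero.1 (hnd.1 _ fun w => ?_)
    rw [map_sub, LinearMap.sub_apply, sub_eq_zero, Module.End.mul_apply, Module.End.mul_apply, ← hA,
      ← Module.End.mul_apply, ← huT, Module.End.mul_apply, hS, ← Module.End.mul_apply, huT,
      Module.End.mul_apply, hA, ← hT]
  obtain ⟨l, hl⟩ := exists_evalOp_eq hf hsep hTf hAT
  have hdet := det_sq_eq_det hnd hA
  have hu0 : LinearMap.det (u : Module.End k W) ≠ 0 :=
    (LinearMap.isUnit_det _ u.isUnit).ne_zero
  have hAu : IsUnit A := by
    rw [LinearMap.isUnit_iff_isUnit_det, ← hdet]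
    exact (IsUnit.mk0 _ hu0).pow 2
  refine ⟨l, isUnit_of_evalOp_isUnit hf hsep hTf (hl ▸ hAu), fun v w => ?_,
    ⟨_, hu0, ?_⟩, u, huT, hl ▸ hA⟩
  · rw [← hl, ← hA, hs.eq, hA, hs.eq]
  · rw [← det_evalOp hf hTf, ← hl, hdet]

end Twist

/-! ## The class of a twist in the cohomology of the stabilizer -/

section Class

variable {k : Type*} (ks : Type*) {W : Type*} [Field k] [Field ks] [Algebra k ks]
  [AddCommGroup W] [Module k W] {B : LinearMap.BilinForm k W} {T S A : Module.End k W}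

theorem baseChange_form_eq {u A : Module.End k W}
    (h : ∀ v w, B (u v) (u w) = B (A v) w) (x y : ks ⊗[k] W) :
    B.baseChange ks (u.baseChange ks x) (u.baseChange ks y) =
      B.baseChange ks (A.baseChange ks x) y := by
  induction x with
  | zero => simp
  | add x x' hx hx' => simp only [map_add, LinearMap.add_apply, hx, hx']
  | tmul a w =>
    induction y with
    | zero => simp
    | add y y' hy hy' => rw [map_add, map_add, map_add, hy, hy']
    | tmul b v => simp [LinearMap.BilinForm.baseChange_tmul, h]

theorem exists_units_baseChange (u : LinearMap.GeneralLinearGroup k W) :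
    ∃ u' : LinearMap.GeneralLinearGroup ks (ks ⊗[k] W),
      (u' : Module.End ks (ks ⊗[k] W)) = (u : Module.End k W).baseChange ks ∧
        ∀ σ : ks ≃ₐ[k] ks, σ • u' = u' :=
  ⟨(baseChange_isUnit (ks := ks) u.isUnit).unit, rfl, fun σ => Units.ext (by
    rw [coe_smul, IsUnit.unit_spec, galEnd_baseChange])⟩

variable {ks}

variable [FiniteDimensional k W]

/-- The class of a twist by `A` is the class of `σ ↦ h⁻¹ σ(h)` with `h* h = A`. -/
theorem IsTwist.isOrbitClass [IsSepClosure k ks] (hB : IsRegular B T) (hA : IsKummerDatum B T A)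
    (hS : IsTwist B T A S) : IsOrbitClass ks B T S (kummerClass ks hB hA) := by
  have := IsSepClosure.separable (k := k) (K := ks)
  obtain ⟨u, hu, huA⟩ := hS
  let h := (exists_kummerElement (ks := ks) hB hA).choose
  have hh : IsKummerElement ks B T A h := (exists_kummerElement hB hA).choose_spec
  obtain ⟨A, rfl⟩ := hA.isUnit
  obtain ⟨us, hus, husσ⟩ := exists_units_baseChange ks u
  obtain ⟨As, hAs, hAsσ⟩ := exists_units_baseChange ks A
  have hAm := baseChange_mem_adjoin ks hA.mem
  have hAh : Commute (As : Module.End ks (ks ⊗[k] W)) h :=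
    hAs ▸ commute_of_mem_adjoin hAm hh.1
  have hAT : Commute (As : Module.End ks (ks ⊗[k] W)) (T.baseChange ks) :=
    hAs ▸ commute_of_mem_adjoin hAm (Algebra.subset_adjoin rfl)
  have hhT : Commute (h : Module.End ks (ks ⊗[k] W)) (T.baseChange ks) :=
    commute_of_mem_adjoin hh.1 (Algebra.subset_adjoin rfl)
  have huT : S.baseChange ks * us = us * T.baseChange ks := by
    rw [hus, ← LinearMap.baseChange_mul, ← LinearMap.baseChange_mul, hu]
  -- Here `A⁻¹ h = (h*)⁻¹`. The isometry `u h⁻¹` would also carry `T` to `S`, but its cocycle is `h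
  -- σ(h)⁻¹`; with `A⁻¹ h` the rational factors `u` and `A` cancel and exactly `h⁻¹ σ(h)` remains.
  let g : LinearMap.GeneralLinearGroup ks (ks ⊗[k] W) := us * (As⁻¹ * h)
  have hgT : S.baseChange ks * g = g * T.baseChange ks := by
    have hc : Commute ((As⁻¹ * h : LinearMap.GeneralLinearGroup ks (ks ⊗[k] W)) :
        Module.End ks (ks ⊗[k] W)) (T.baseChange ks) := by
      rw [Units.val_mul]
      exact hAT.units_inv_left.mul_left hhT
    rw [Units.val_mul, ← mul_assoc, huT, mul_assoc, ← hc.eq, mul_assoc]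
  have hgB : ∀ v w, B.baseChange ks ((g : Module.End ks (ks ⊗[k] W)) v)
      ((g : Module.End ks (ks ⊗[k] W)) w) = B.baseChange ks v w := by
    intro v w
    have h1 : ((As⁻¹ * h : LinearMap.GeneralLinearGroup ks (ks ⊗[k] W)) :
        Module.End ks (ks ⊗[k] W)) w = (h : Module.End ks (ks ⊗[k] W))
          (((As⁻¹ : LinearMap.GeneralLinearGroup ks (ks ⊗[k] W)) : Module.End ks (ks ⊗[k] W)) w) := by
      rw [Units.val_mul, hAh.units_inv_left.eq, Module.End.mul_apply]
    rw [Units.val_mul, Module.End.mul_apply, Module.End.mul_apply, hus, baseChange_form_eq ks huA, h1,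
      ← hAs, Units.val_mul, Module.End.mul_apply, mul_inv_apply', hh.2,
      baseChange_selfAdjoint hA.selfAdjoint, ← hAs, mul_inv_apply']
  have hdet : LinearMap.det (g : Module.End ks (ks ⊗[k] W)) ^ 2 = 1 := by
    have := det_sq_of_isometry (ks := ks) (a := 1) hB.nondegenerate hgB
    rwa [map_one] at this
  have hodd : Odd (Module.finrank ks (ks ⊗[k] W)) := by
    rw [Module.finrank_baseChange]
    exact hB.odd
  have hgS := (Units.eq_mul_inv_iff_mul_eq g).2 hgT
  have hgσ : ∀ σ : ks ≃ₐ[k] ks, g⁻¹ * σ • g = h⁻¹ * σ • h := fun σ => by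
    simp only [g, smul_mul', smul_inv', husσ, hAsσ]
    group
  -- The correcting sign is central and Galois-fixed, so it changes neither the conjugate of `T` nor
  -- the cocycle.
  obtain ⟨e, he, hg⟩ := exists_mem_SO_of_isometry hodd hgB hdet
  have heσ : ∀ σ : ks ≃ₐ[k] ks, σ • scalarGL ks (ks ⊗[k] W) e = scalarGL ks (ks ⊗[k] W) e :=
    fun σ => Units.ext (by
      change galEnd ks σ (algebraMap ks _ e) = algebraMap ks _ (e : ks)
      rw [galEnd_algebraMap]
      rcases he with rfl | rfl <;> simp)
  refine ⟨_, hg, by rw [scalarGL_mul_conj, ← hgS], kummerCocycle hB hA h hh, fun σ => ?_, rfl⟩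
  rw [smul_mul', heσ, mul_inv_rev, mul_assoc, inv_mul_cancel_left]
  exact (hgσ σ).symm

/-- The cocycle `σ ↦ g⁻¹ σ(g)` is a coboundary in `SO(W)(kˢ)`, because `g` lies there. -/
theorem stabilizerMap_eq_base_of_isOrbitClass {x : H1 (ks ≃ₐ[k] ks) (stabilizer ks B T)}
    (h : IsOrbitClass ks B T S x) : stabilizerMap ks B T x = H1.base _ _ := by
  obtain ⟨g, hg, -, a, ha, rfl⟩ := h
  refine Quotient.sound (s := cohomologous _ _) ⟨⟨g, hg⟩⁻¹, fun σ => Subtype.ext ?_⟩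
  change (1 : LinearMap.GeneralLinearGroup ks (ks ⊗[k] W)) = (g⁻¹)⁻¹ *
    (a.toFun σ : LinearMap.GeneralLinearGroup ks (ks ⊗[k] W)) * σ • g⁻¹
  rw [ha, smul_inv']
  group

/-- If `h⁻¹ σ(h)` is trivialized by `C` in `SO(W)(kˢ)`, then `h C` is Galois-fixed. It yields an
isometry over `k` from `W` with the form `⟨A v, w⟩` to `W`, along which `T` is transported to `S`.
-/
theorem exists_isTwist_of_stabilizerMap_eq_base [IsSepClosure k ks] (hB : IsRegular B T)
    (hA : IsKummerDatum B T A)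
    (hbase : stabilizerMap ks B T (kummerClass ks hB hA) = H1.base _ _) : ∃ S, IsTwist B T A S := by
  have := IsSepClosure.separable (k := k) (K := ks)
  let h := (exists_kummerElement (ks := ks) hB hA).choose
  have hh : IsKummerElement ks B T A h := (exists_kummerElement hB hA).choose_spec
  obtain ⟨c, hc⟩ := Quotient.exact (s := cohomologous _ _) hbase
  obtain ⟨A, rfl⟩ := hA.isUnit
  obtain ⟨As, hAs, hAsσ⟩ := exists_units_baseChange ks A
  let C : LinearMap.GeneralLinearGroup ks (ks ⊗[k] W) := c
  have hc' : ∀ σ : ks ≃ₐ[k] ks, (1 : LinearMap.GeneralLinearGroup ks (ks ⊗[k] W)) =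
      C⁻¹ * (h⁻¹ * σ • h) * σ • C := fun σ => congrArg Subtype.val (hc σ)
  have hAm := baseChange_mem_adjoin ks hA.mem
  have hAh : Commute (As : Module.End ks (ks ⊗[k] W)) h :=
    hAs ▸ commute_of_mem_adjoin hAm hh.1
  -- This is `(h C)⁻¹ A`, a product of Galois-fixed operators. Since `h⁻¹ A = h*` and `h*` commutes
  -- with `h`, it carries the form `⟨A v, w⟩` to `B`, the isometry `C⁻¹` having no effect.
  let g : LinearMap.GeneralLinearGroup ks (ks ⊗[k] W) := C⁻¹ * (h⁻¹ * As)
  have hgσ : ∀ σ : ks ≃ₐ[k] ks, σ • g = g := fun σ => by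
    have h1 : σ • (C⁻¹ * h⁻¹) = C⁻¹ * h⁻¹ := by
      rw [← mul_inv_rev, smul_inv', smul_mul', inv_inj]
      have := hc' σ
      rw [mul_assoc, eq_inv_mul_iff_mul_eq, mul_one, mul_assoc, eq_inv_mul_iff_mul_eq] at this
      exact this.symm
    simp only [g]
    rw [← mul_assoc, smul_mul', h1, hAsσ]
  have hgB : ∀ v w, B.baseChange ks ((g : Module.End ks (ks ⊗[k] W)) v)
      ((g : Module.End ks (ks ⊗[k] W)) w) =
        B.baseChange ks ((A : Module.End k W).baseChange ks v) w := by
    intro v w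
    have h1 : ((h⁻¹ * As : LinearMap.GeneralLinearGroup ks (ks ⊗[k] W)) :
        Module.End ks (ks ⊗[k] W)) v = (As : Module.End ks (ks ⊗[k] W))
          (((h⁻¹ : LinearMap.GeneralLinearGroup ks (ks ⊗[k] W)) : Module.End ks (ks ⊗[k] W)) v) := by
      rw [Units.val_mul, ← hAh.units_inv_right.eq, Module.End.mul_apply]
    rw [Units.val_mul, Module.End.mul_apply, Module.End.mul_apply, (inv_mem c.2).1, h1, hAs,
      ← hh.2, mul_inv_apply', Units.val_mul, Module.End.mul_apply, mul_inv_apply', hAs,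
      baseChange_selfAdjoint hA.selfAdjoint]
  obtain ⟨u, hu⟩ := exists_baseChange_eq (g := (g : Module.End ks (ks ⊗[k] W)))
    fun σ => congrArg Units.val (hgσ σ)
  have huu : IsUnit u := by
    rw [LinearMap.isUnit_iff_isUnit_det, isUnit_iff_ne_zero]
    intro h0
    have h1 := (LinearMap.isUnit_det _ g.isUnit).ne_zero
    rw [← hu, LinearMap.det_baseChange, h0, map_zero] at h1
    exact h1 rfl
  obtain ⟨u, rfl⟩ := huu
  refine ⟨u * T * (u⁻¹ : LinearMap.GeneralLinearGroup k W), u, Units.inv_mul_cancel_right _ _,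
    fun v w => (algebraMap k ks).injective ?_⟩
  -- The identity of forms over `kˢ` descends by evaluating it on rational vectors.
  have h1 := hgB (1 ⊗ₜ v) (1 ⊗ₜ w)
  rw [← hu] at h1
  simpa [LinearMap.BilinForm.baseChange_tmul, Algebra.algebraMap_eq_smul_one] using h1

end Class

/-! ## Orbits and classes -/

/-- A relation `r` between operators and classes which separates orbits induces a bijection
between orbits and classes. -/
theorem exists_orbit_equiv {E C : Type*} (orb : E → Set E) (hself : ∀ S, S ∈ orb S)
    (horb : ∀ S S', S' ∈ orb S → orb S' = orb S) {P : E → Prop} {K : C → Prop} {r : E → C → Prop}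
    {T : E} {c₀ : C} (hP : ∀ S S', P S → S' ∈ orb S → P S') (hex : ∀ S, P S → ∃ c, r S c)
    (hK : ∀ S c, r S c → K c) (hK' : ∀ c, K c → ∃ S, P S ∧ r S c)
    (hr : ∀ S S' c c', r S c → r S' c' → (orb S = orb S' ↔ c = c'))
    (hTc : r T c₀) :
    ∃ Φ : {O : Set E // (∃ S, P S ∧ O = orb S) ∧ O ≠ orb T} ≃ {c : C // K c ∧ c ≠ c₀},
      ∀ O, ∀ S ∈ O.1, r S (Φ O).1 := by
  have H : ∀ O : {O : Set E // (∃ S, P S ∧ O = orb S) ∧ O ≠ orb T},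
      ∃ c : {c : C // K c ∧ c ≠ c₀}, ∀ S ∈ O.1, r S c.1 := by
    rintro ⟨_, ⟨S, hS, rfl⟩, hne⟩
    obtain ⟨c, hc⟩ := hex S hS
    refine ⟨⟨c, hK S c hc, fun h => hne ((hr _ _ _ _ hc hTc).2 h)⟩, fun S' hS' => ?_⟩
    obtain ⟨c', hc'⟩ := hex S' (hP S S' hS hS')
    change r S' c
    rwa [← (hr _ _ _ _ hc' hc).1 (horb S S' hS')]
  choose φ hφ using H
  refine ⟨Equiv.ofBijective φ ⟨?_, ?_⟩, hφ⟩
  · intro O O' h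
    obtain ⟨_, ⟨S, hS, rfl⟩, hne⟩ := O
    obtain ⟨_, ⟨S', hS', rfl⟩, hne'⟩ := O'
    exact Subtype.ext ((hr _ _ _ _ (hφ _ S (hself S)) (hφ _ S' (hself S'))).2
      (congrArg Subtype.val h))
  · rintro ⟨c, hc, hc₀⟩
    obtain ⟨S, hS, hSc⟩ := hK' c hc
    refine ⟨⟨orb S, ⟨S, hS, rfl⟩, fun h => hc₀ ((hr _ _ _ _ hSc hTc).1 h)⟩, Subtype.ext ?_⟩
    exact (hr _ _ _ _ (hφ _ S (hself S)) hSc).1 rfl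

section

variable {k : Type*} {ks : Type*} {W : Type*} [Field k] [Field ks] [Algebra k ks]
  [AddCommGroup W] [Module k W] {B : LinearMap.BilinForm k W}
  {S T : Module.End k W} {n : ℕ}

theorem IsOrbitClass.mem_orbit [FiniteDimensional k W] {x : H1 (ks ≃ₐ[k] ks) (stabilizer ks B T)}
    (h : IsOrbitClass ks B T S x) :
    S.baseChange ks ∈ orbit (B.baseChange ks) (T.baseChange ks) := by
  obtain ⟨g, hg, hS, -⟩ := h
  exact ⟨g, hg, hS⟩

theorem evalOp_alpha_one [FiniteDimensional k W]
    {g : k[X]} (hg : g.Monic) (hsep : (oddPoly g).Separable)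
    (hT : T.charpoly = oddPoly g) : evalOp (oddPoly_monic hg) T (alpha hsep 1) = 1 := by
  have h : alpha hsep 1 = 1 := by
    rw [alpha, Units.val_one, map_one, ← Prod.one_eq_mk, map_one]
  rw [h, evalOp_one _ (aeval_eq_zero hT)]

/-! ### Self-adjoint operators -/

variable {f : k[X]}

theorem IsSelfAdjointOp.of_isTwist [FiniteDimensional k W]
    {A : Module.End k W} (hT : IsSelfAdjointOp B f T)
    (hS : IsTwist B T A S) (hA : Commute A T) : IsSelfAdjointOp B f S where
  selfAdjoint v w := by
    rw [hS.adjoint (s := 1) (fun v w => by rw [hT.selfAdjoint, one_mul]) hA, one_mul]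
  charpoly := by rw [hS.charpoly, hT.charpoly]

theorem evalOp_commute (hf : f.Monic) (T : Module.End k W) (l : AdjoinRoot f) :
    Commute (evalOp hf T l) T :=
  commute_of_mem_adjoin (evalOp_mem hf T l) (Algebra.subset_adjoin rfl)

/-- Two intertwining maps for the same `S` differ by an element `u` of `L*`. Elements of `L` are
self-adjoint, so this changes `α` into `u α u = α u²`. -/
theorem mk_eq_of_isTwist_selfAdjoint [FiniteDimensional k W]
    (hnd : B.Nondegenerate) (hf : f.Monic) (hsep : f.Separable)
    (hT : IsSelfAdjointOp B f T) {α β : (AdjoinRoot f)ˣ} (hα : IsTwist B T (evalOp hf T α) S)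
    (hβ : IsTwist B T (evalOp hf T β) S) :
    (QuotientGroup.mk α : (AdjoinRoot f)ˣ ⧸ squares (AdjoinRoot f)) = QuotientGroup.mk β := by
  have hT0 := aeval_eq_zero hT.charpoly
  obtain ⟨l, hl, h⟩ := hα.exists_commute hβ
  obtain ⟨m, hm⟩ := exists_evalOp_eq hf hsep hT.charpoly hl
  obtain ⟨u, rfl⟩ := isUnit_of_evalOp_isUnit hf hsep hT.charpoly (hm ▸ l.isUnit)
  have h1 : evalOp hf T β = evalOp hf T (u * (α * u)) := LinearMap.ext fun v => by
    refine sub_eq_zero.1 (hnd.1 _ fun w => ?_)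
    rw [map_sub, LinearMap.sub_apply, sub_eq_zero, h, hm,
      ← adjoin_selfAdjoint hT.selfAdjoint (evalOp_mem hf T u), evalOp_mul _ hT0, evalOp_mul _ hT0,
      Module.End.mul_apply, Module.End.mul_apply]
  have h2 := evalOp_injective hf hsep hT.charpoly h1
  refine QuotientGroup.eq.2 ⟨u, ?_⟩
  rw [eq_inv_mul_iff_mul_eq]
  refine Units.ext ?_
  rw [h2]
  simp only [powMonoidHom_apply, Units.val_mul, Units.val_pow_eq_pow_val]
  ring

theorem IsTwist.of_mk_eq_selfAdjoint [FiniteDimensional k W]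
    (hf : f.Monic) (hT : IsSelfAdjointOp B f T)
    {α β : (AdjoinRoot f)ˣ}
    (h : (QuotientGroup.mk α : (AdjoinRoot f)ˣ ⧸ squares (AdjoinRoot f)) = QuotientGroup.mk β)
    (hα : IsTwist B T (evalOp hf T α) S) : IsTwist B T (evalOp hf T β) S := by
  obtain ⟨l, hl, ⟨l, rfl⟩, hl'⟩ := selfAdjoint_wellDefined hf hT α β h
  exact hα.trans (commute_of_mem_adjoin hl (Algebra.subset_adjoin rfl)) hl'

theorem norm_mem_normOne {α : (AdjoinRoot f)ˣ} {c : k} (hc : c ≠ 0)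
    (h : Algebra.norm k (α : AdjoinRoot f) = c ^ 2) :
    (QuotientGroup.mk α : (AdjoinRoot f)ˣ ⧸ squares (AdjoinRoot f)) ∈ normOne f := by
  rw [MonoidHom.mem_ker]
  change (QuotientGroup.mk (Units.map (Algebra.norm k : AdjoinRoot f →* k) α) : kˣ ⧸ squares k) = 1
  rw [QuotientGroup.eq_one_iff]
  exact ⟨Units.mk0 c hc, Units.ext (by simpa using h.symm)⟩

theorem selfAdjoint_classification [FiniteDimensional k W] [IsSepClosure k ks] (h2 : (2 : k) ≠ 0)
    (hB : IsSplitOrthogonal n B) (hf : f.Monic) (hsep : f.Separable)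
    (hT : IsSelfAdjointOp B f T) :
    (∀ S, IsSelfAdjointOp B f S →
      S.baseChange ks ∈ orbit (B.baseChange ks) (T.baseChange ks)) ∧
    ∃ Φ : {O : Set (Module.End k W) //
          (∃ S, IsSelfAdjointOp B f S ∧ O = orbit B S) ∧ O ≠ orbit B T} ≃
        {c : normOne f // gammaSelfAdjoint ks h2 hB hf hsep hT c = H1.base _ _ ∧ c ≠ 1},
      ∀ O, ∀ S ∈ O.1,
        IsOrbitClass ks B T S (deltaSelfAdjoint ks h2 hB hf hsep hT (Φ O).1) := by
  have hodd : Odd (Module.finrank k W) := ⟨n, hB.finrank⟩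
  have hT0 := aeval_eq_zero hT.charpoly
  have hreg := isRegular_of h2 hB hT.charpoly hsep
  -- The bridge between operators and classes: `S` is a twist of `T` by some representative of `c`.
  let r : Module.End k W → normOne f → Prop := fun S c =>
    ∃ α : (AdjoinRoot f)ˣ, QuotientGroup.mk α = c.1 ∧ IsTwist B T (evalOp hf T α) S
  have hex : ∀ S, IsSelfAdjointOp B f S → ∃ c, r S c := fun S hS => by
    obtain ⟨l, ⟨α, rfl⟩, -, ⟨c, hc, hN⟩, htw⟩ := exists_isTwist (s := 1) hB.symm hB.nondegenerate hf
      hsep hT.charpoly hS.charpoly (fun v w => by rw [hT.selfAdjoint, one_mul])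
      (fun v w => by rw [hS.selfAdjoint, one_mul])
    exact ⟨⟨QuotientGroup.mk α, norm_mem_normOne hc hN⟩, α, rfl, htw⟩
  have hclass : ∀ S c, r S c →
      IsOrbitClass ks B T S (deltaSelfAdjoint ks h2 hB hf hsep hT c) := by
    rintro S ⟨_, hc⟩ ⟨α, rfl, htw⟩
    rw [deltaSelfAdjoint_mk]
    exact htw.isOrbitClass hreg _
  refine ⟨fun S hS => ?_, ?_⟩
  · obtain ⟨c, hc⟩ := hex S hS
    exact (hclass S c hc).mem_orbit
  obtain ⟨Φ, hΦ⟩ := exists_orbit_equiv (orbit B) mem_orbit_self (fun _ _ => orbit_eq_of_mem)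
    (K := fun c => gammaSelfAdjoint ks h2 hB hf hsep hT c = H1.base _ _) (r := r) (T := T)
    (c₀ := (1 : normOne f))
    -- A member of the orbit of `S` is a twist of `S` by `1`, hence of the same type as `S`.
    (fun S S' hS hS' => hS.of_isTwist (isTwist_one.of_mem_orbit hS') (Commute.one_left _)) hex
    (fun S c hc => stabilizerMap_eq_base_of_isOrbitClass (hclass S c hc))
    (by
      rintro ⟨c, hc⟩ hK
      obtain ⟨α, rfl⟩ := QuotientGroup.mk_surjective c
      -- The connecting map is defined by a chosen representative; this passes to `α`, so that the
      -- twist obtained is by `α` itself.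
      rw [gammaSelfAdjoint, deltaSelfAdjoint_mk] at hK
      obtain ⟨S, hS⟩ := exists_isTwist_of_stabilizerMap_eq_base _ _ hK
      exact ⟨S, hT.of_isTwist hS (evalOp_commute hf T α), α, rfl, hS⟩)
    (by
      rintro S S' ⟨_, hc⟩ ⟨_, hc'⟩ ⟨α, rfl, hα⟩ ⟨β, rfl, hβ⟩
      refine ⟨fun h => Subtype.ext ?_, fun h => ?_⟩
      · have hS' : S' ∈ orbit B S := h ▸ mem_orbit_self S'
        exact mk_eq_of_isTwist_selfAdjoint hB.nondegenerate hf hsep hT (hα.of_mem_orbit hS') hβ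
      · exact (orbit_eq_of_mem ((IsTwist.of_mk_eq_selfAdjoint hf hT
          (congrArg Subtype.val h) hα).mem_orbit hodd hB.nondegenerate hβ)).symm)
    ⟨1, rfl, by rw [Units.val_one, evalOp_one hf hT0]; exact isTwist_one⟩
  exact ⟨Φ, fun O S hS => hclass S _ (hΦ O S hS)⟩

/-! ### Skew self-adjoint operators -/

variable {g : k[X]}

theorem algebraMap_KE_injective [Nontrivial (algK g)] :
    Function.Injective (algebraMap (algK g) (algE g)) := by
  obtain ⟨b, h0, -⟩ := exists_basis_E g
  intro x y h
  rw [Algebra.algebraMap_eq_smul_one, Algebra.algebraMap_eq_smul_one, ← h0] at h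
  have := congrArg (fun z => b.repr z 0) h
  simpa using this

/-- The elements of `E` fixed by the involution `x ↦ -x` are those of `K`. -/
theorem exists_algebraMap_eq_of_tauE_eq (h2 : (2 : k) ≠ 0) [Nontrivial (algK g)] {ε : algE g}
    (hε : tauE g ε = ε) : ∃ κ, algebraMap (algK g) (algE g) κ = ε := by
  obtain ⟨b, h0, h1⟩ := exists_basis_E g
  have hs := b.sum_repr ε
  rw [Fin.sum_univ_two, h0, h1] at hs
  have ht : tauE g ε = b.repr ε 0 • 1 - b.repr ε 1 • AdjoinRoot.root (expand k 2 g) := by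
    conv_lhs => rw [← hs]
    simp only [Algebra.smul_def, map_add, map_mul, tauE_algebraMap, tauE_root, map_one]
    ring
  -- Writing `ε = a + c x` in the basis `1, x` of `E` over `K`, invariance under `x ↦ -x` gives `2 c
  -- x = 0`.
  have h3 : (2 : algK g) * b.repr ε 1 = 0 := by
    have h4 : ((2 : algK g) * b.repr ε 1) • b 1 = 0 := by
      rw [h1, mul_smul, ofNat_smul_eq_nsmul, two_nsmul]
      have h5 := hs.trans (hε.symm.trans ht)
      rw [sub_eq_add_neg, add_right_inj, eq_neg_iff_add_eq_zero] at h5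
      exact h5
    have := congrArg (fun z => b.repr z 1) h4
    simpa using this
  have h2K : IsUnit (2 : algK g) := by
    have := (IsUnit.mk0 _ h2).map (algebraMap k (algK g))
    rwa [map_ofNat] at this
  have h4 : b.repr ε 1 = 0 := (h2K.mul_right_eq_zero).1 h3
  refine ⟨b.repr ε 0, ?_⟩
  rw [h4, zero_smul, add_zero] at hs
  rw [Algebra.algebraMap_eq_smul_one, hs]

/-- The norm from `E` to `K` sends the image of `κ` to `κ²`, which is therefore a unit. -/
theorem isUnit_of_algebraMap_KE [Nontrivial (algK g)] {κ : algK g}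
    (h : IsUnit (algebraMap (algK g) (algE g) κ)) : IsUnit κ := by
  obtain ⟨b, -, -⟩ := exists_basis_E g
  have h1 := h.map (Algebra.norm (algK g))
  rw [Algebra.norm_algebraMap_of_basis b, Fintype.card_fin] at h1
  exact (isUnit_pow_iff two_ne_zero).1 h1

theorem tauE_mk (q : k[X]) :
    tauE g (AdjoinRoot.mk _ q) = AdjoinRoot.mk (expand k 2 g) (q.comp (-X)) := by
  change aeval (-AdjoinRoot.root (expand k 2 g)) q = _
  rw [← AdjoinRoot.aeval_eq, aeval_comp]
  simp

theorem IsSkewOp.of_isTwist [FiniteDimensional k W] {A : Module.End k W} (hT : IsSkewOp B f T)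
    (hS : IsTwist B T A S) (hA : Commute A T) : IsSkewOp B f S where
  skew v w := by
    rw [hS.adjoint (s := -1) (fun v w => by rw [hT.skew, neg_one_mul]) hA, neg_one_mul]
  charpoly := by rw [hS.charpoly, hT.charpoly]

/-- The two intertwining maps differ by some `q(T)`, whose adjoint is `q(-T)`. In the component `E`
this reads `κ' = q^τ κ q`, so `κ'/κ` is the norm of the unit `q`. -/
theorem mk_eq_of_isTwist_skew [FiniteDimensional k W]
    [Nontrivial (algK g)] (hnd : B.Nondegenerate) (hg : g.Monic)
    (hsep : (oddPoly g).Separable) (hT : IsSkewOp B (oddPoly g) T) {κ κ' : (algK g)ˣ}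
    (hκ : IsTwist B T (evalOp (oddPoly_monic hg) T (alpha hsep κ)) S)
    (hκ' : IsTwist B T (evalOp (oddPoly_monic hg) T (alpha hsep κ')) S) :
    (QuotientGroup.mk κ : (algK g)ˣ ⧸ normSubgroup g) = QuotientGroup.mk κ' := by
  have hf := oddPoly_monic hg
  have hT0 := aeval_eq_zero hT.charpoly
  obtain ⟨l, hl, h⟩ := hκ.exists_commute hκ'
  obtain ⟨m, hm⟩ := exists_evalOp_eq hf hsep hT.charpoly hl
  have hmu := isUnit_of_evalOp_isUnit hf hsep hT.charpoly (hm ▸ l.isUnit)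
  obtain ⟨q, rfl⟩ := AdjoinRoot.mk_surjective m
  have h1 : evalOp hf T (alpha hsep κ') =
      evalOp hf T (AdjoinRoot.mk _ (q.comp (-X)) * (alpha hsep κ * AdjoinRoot.mk _ q)) :=
    LinearMap.ext fun v => by
      refine sub_eq_zero.1 (hnd.1 _ fun w => ?_)
      rw [map_sub, LinearMap.sub_apply, sub_eq_zero, h, hm, evalOp_mul _ hT0, evalOp_mul _ hT0,
        Module.End.mul_apply, Module.End.mul_apply, evalOp_mk hf hT0, evalOp_mk hf hT0,
        adjoint_aeval hT]
  have h3 := congrArg (fun x => (equivL hsep x).1) (evalOp_injective hf hsep hT.charpoly h1)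
  simp only [map_mul, Prod.fst_mul, equivL_mk, alpha, AlgEquiv.apply_symm_apply, ← tauE_mk] at h3
  obtain ⟨u, hu⟩ : IsUnit (AdjoinRoot.mk (expand k 2 g) q) := by
    have := (Prod.isUnit_iff.1 (hmu.map (equivL hsep))).1
    rwa [equivL_mk] at this
  refine QuotientGroup.eq.2 ⟨u, ?_⟩
  rw [eq_inv_mul_iff_mul_eq]
  refine Units.ext (algebraMap_KE_injective ?_)
  rw [h3, ← hu, Units.val_mul, map_mul]
  change _ * algebraMap (algK g) (algE g) (Algebra.norm (algK g) (u : algE g)) = _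
  rw [norm_E]
  ring

theorem IsTwist.of_mk_eq_skew [FiniteDimensional k W] (hg : g.Monic) (hsep : (oddPoly g).Separable)
    (hT : IsSkewOp B (oddPoly g) T) {κ κ' : (algK g)ˣ}
    (h : (QuotientGroup.mk κ : (algK g)ˣ ⧸ normSubgroup g) = QuotientGroup.mk κ')
    (hκ : IsTwist B T (evalOp (oddPoly_monic hg) T (alpha hsep κ)) S) :
    IsTwist B T (evalOp (oddPoly_monic hg) T (alpha hsep κ')) S := by
  obtain ⟨l, hl, ⟨l, rfl⟩, hl'⟩ := skew_wellDefined hg hsep hT κ κ' (QuotientGroup.eq.1 h)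
  exact hκ.trans (commute_of_mem_adjoin hl (Algebra.subset_adjoin rfl)) hl'

/-- Self-adjointness of `α(T)` means that `α` is fixed by `τ`, so its component in `E` comes from
some `κ` in `K*`. The norm of `α` is then `N(κ)²` times its component in `k`; as it is a square,
that component is a square `e²`, and the scalar `e⁻¹` brings `α` to the form `(κ', 1)`. -/
theorem exists_isTwist_alpha [FiniteDimensional k W]
    [Nontrivial (algK g)] (h2 : (2 : k) ≠ 0) (hs : B.IsSymm)
    (hnd : B.Nondegenerate) (hg : g.Monic) (hsep : (oddPoly g).Separable)
    (hT : IsSkewOp B (oddPoly g) T) (hS : IsSkewOp B (oddPoly g) S) :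
    ∃ κ : (algK g)ˣ, IsTwist B T (evalOp (oddPoly_monic hg) T (alpha hsep κ)) S := by
  have hf := oddPoly_monic hg
  have hT0 := aeval_eq_zero hT.charpoly
  obtain ⟨l, hlu, hadj, ⟨c, hc, hN⟩, htw⟩ := exists_isTwist (s := -1) hs hnd hf
    hsep hT.charpoly hS.charpoly (fun v w => by rw [hT.skew, neg_one_mul])
    (fun v w => by rw [hS.skew, neg_one_mul])
  have hfix : tauE g (equivL hsep l).1 = (equivL hsep l).1 := by
    obtain ⟨p, rfl⟩ := AdjoinRoot.mk_surjective l
    have h1 : evalOp hf T (AdjoinRoot.mk _ p) = evalOp hf T (AdjoinRoot.mk _ (p.comp (-X))) :=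
      LinearMap.ext fun v => by
        refine sub_eq_zero.1 (hnd.1 _ fun w => ?_)
        rw [map_sub, LinearMap.sub_apply, sub_eq_zero, hadj, evalOp_mk hf hT0, evalOp_mk hf hT0,
          adjoint_aeval hT]
    have h3 := congrArg (fun x => (equivL hsep x).1) (evalOp_injective hf hsep hT.charpoly h1)
    simp only [equivL_mk] at h3 ⊢
    rw [tauE_mk, ← h3]
  obtain ⟨κ, hκ⟩ := exists_algebraMap_eq_of_tauE_eq h2 hfix
  obtain ⟨κ, rfl⟩ : IsUnit κ :=
    isUnit_of_algebraMap_KE (hκ ▸ (Prod.isUnit_iff.1 (hlu.map (equivL hsep))).1)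
  rw [norm_equivL hg hsep, ← hκ, norm_KE g hg] at hN
  have hNκ : Algebra.norm k (κ : algK g) ≠ 0 := (κ.isUnit.map (Algebra.norm k)).ne_zero
  let e : kˣ := Units.mk0 (c / Algebra.norm k (κ : algK g)) (div_ne_zero hc hNκ)
  have he : (equivL hsep l).2 = (e : k) ^ 2 := by
    rw [Units.val_mk0, div_pow, ← hN, mul_div_cancel_left₀ _ (pow_ne_zero 2 hNκ)]
  -- Twisting through the scalar `e⁻¹` multiplies `α` by `e⁻²` in both components, since a scalar is
  -- its own adjoint.
  let κ' : (algK g)ˣ := Units.map (algebraMap k (algK g)).toMonoidHom (e⁻¹ ^ 2) * κ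
  have hκ' : alpha hsep κ' = ((e⁻¹ ^ 2 : kˣ) : k) • l := by
    rw [alpha, AlgEquiv.symm_apply_eq, map_smul]
    refine Prod.ext ?_ ?_
    · rw [Prod.smul_fst, ← hκ, Units.val_mul, map_mul, Algebra.smul_def]
      exact congrArg (· * algebraMap (algK g) (algE g) κ)
        (IsScalarTower.algebraMap_apply k (algK g) (algE g) _).symm
    · rw [Prod.smul_snd, he]
      simp
  refine ⟨κ', htw.trans (l := scalarGL k W e⁻¹) (Algebra.commutes _ _) fun v w => ?_⟩
  rw [hκ', evalOp, map_smul, map_smul, ← evalOp]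
  change _ = B (evalOp hf T l (((e⁻¹ : kˣ) : k) • v)) (((e⁻¹ : kˣ) : k) • w)
  simp only [map_smul, LinearMap.smul_apply, smul_smul, Units.val_mul, sq]

theorem skew_classification [FiniteDimensional k W]
    [IsSepClosure k ks] [Nontrivial (algK g)] (h2 : (2 : k) ≠ 0)
    (hB : IsSplitOrthogonal n B) (hg : g.Monic) (hsep : (oddPoly g).Separable)
    (hT : IsSkewOp B (oddPoly g) T) :
    (∀ S, IsSkewOp B (oddPoly g) S →
      S.baseChange ks ∈ orbit (B.baseChange ks) (T.baseChange ks)) ∧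
    ∃ Φ : {O : Set (Module.End k W) //
          (∃ S, IsSkewOp B (oddPoly g) S ∧ O = orbit B S) ∧ O ≠ orbit B T} ≃
        {c : (algK g)ˣ ⧸ normSubgroup g //
          gammaSkew ks h2 hB hg hsep hT c = H1.base _ _ ∧ c ≠ 1},
      ∀ O, ∀ S ∈ O.1, IsOrbitClass ks B T S (deltaSkew ks h2 hB hg hsep hT (Φ O).1) := by
  have hodd : Odd (Module.finrank k W) := ⟨n, hB.finrank⟩
  have hreg := isRegular_of h2 hB hT.charpoly hsep
  let r : Module.End k W → (algK g)ˣ ⧸ normSubgroup g → Prop := fun S c =>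
    ∃ κ : (algK g)ˣ, QuotientGroup.mk κ = c ∧
      IsTwist B T (evalOp (oddPoly_monic hg) T (alpha hsep κ)) S
  have hex : ∀ S, IsSkewOp B (oddPoly g) S → ∃ c, r S c := fun S hS => by
    obtain ⟨κ, hκ⟩ := exists_isTwist_alpha h2 hB.symm hB.nondegenerate hg hsep hT hS
    exact ⟨_, κ, rfl, hκ⟩
  have hclass : ∀ S c, r S c → IsOrbitClass ks B T S (deltaSkew ks h2 hB hg hsep hT c) := by
    rintro S _ ⟨κ, rfl, htw⟩
    -- On the class of `κ` the connecting map unfolds definitionally to the class attached to `α =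
    -- (κ, 1)`.
    exact htw.isOrbitClass hreg (skew_datum hg hsep hT κ)
  refine ⟨fun S hS => ?_, ?_⟩
  · obtain ⟨c, hc⟩ := hex S hS
    exact (hclass S c hc).mem_orbit
  obtain ⟨Φ, hΦ⟩ := exists_orbit_equiv (orbit B) mem_orbit_self (fun _ _ => orbit_eq_of_mem)
    (K := fun c => gammaSkew ks h2 hB hg hsep hT c = H1.base _ _) (r := r) (T := T)
    (c₀ := (1 : (algK g)ˣ ⧸ normSubgroup g))
    (fun S S' hS hS' => hS.of_isTwist (isTwist_one.of_mem_orbit hS') (Commute.one_left _)) hex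
    (fun S c hc => stabilizerMap_eq_base_of_isOrbitClass (hclass S c hc))
    (by
      intro c hK
      obtain ⟨κ, rfl⟩ := QuotientGroup.mk_surjective c
      obtain ⟨S, hS⟩ :=
        exists_isTwist_of_stabilizerMap_eq_base hreg (skew_datum hg hsep hT κ) hK
      exact ⟨S, hT.of_isTwist hS (evalOp_commute _ T _), κ, rfl, hS⟩)
    (by
      rintro S S' _ _ ⟨κ, rfl, hκ⟩ ⟨κ', rfl, hκ'⟩
      refine ⟨fun h => ?_, fun h => ?_⟩
      · have hS' : S' ∈ orbit B S := h ▸ mem_orbit_self S'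
        exact mk_eq_of_isTwist_skew hB.nondegenerate hg hsep hT (hκ.of_mem_orbit hS') hκ'
      · exact (orbit_eq_of_mem ((IsTwist.of_mk_eq_skew hg hsep hT h hκ).mem_orbit hodd
          hB.nondegenerate hκ')).symm)
    ⟨1, rfl, by rw [evalOp_alpha_one hg hsep hT.charpoly]; exact isTwist_one⟩
  exact ⟨Φ, fun O S hS => hclass S _ (hΦ O S hS)⟩

/-! ### Distinguished operators -/

theorem exists_distinguished_skew [FiniteDimensional k W]
    (h2 : (2 : k) ≠ 0) (hB : IsSplitOrthogonal n B) (hg : g.Monic)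
    (hdeg : g.natDegree = n) : ∃ T, IsSkewOp B (oddPoly g) T ∧
      {S | IsDistinguishedSkew n hg B S} = orbit B T := by
  have hd : (oddPoly g).natDegree = 2 * n + 1 := by
    rw [natDegree_mul X_ne_zero (hg.expand two_pos).ne_zero, natDegree_X, natDegree_expand, hdeg]
    ring
  -- With `s = -1` the general form carries the factor `(-1)ⁿ` and the involution `x ↦ -x`, as in
  -- the definition of a distinguished skew operator.
  obtain ⟨T, hT, hTf, horb⟩ := exists_distinguished (s := (-1 : k)) (τ := tauL g) h2 hB
    (oddPoly_monic hg) hd (by ring) (by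
      rw [tauL, AdjoinRoot.liftAlgHom_root]
      simp)
  exact ⟨T, ⟨fun v w => by rw [hT, neg_one_mul], hTf⟩, horb⟩

theorem exists_distinguished_selfAdjoint [FiniteDimensional k W]
    (h2 : (2 : k) ≠ 0) (hB : IsSplitOrthogonal n B)
    (hf : f.Monic) (hdeg : f.natDegree = 2 * n + 1) : ∃ T, IsSelfAdjointOp B f T ∧
      {S | IsDistinguishedSelfAdjoint n hf B S} = orbit B T := by
  obtain ⟨T, hT, hTf, horb⟩ := exists_distinguished (s := (1 : k)) (τ := AlgHom.id k _) h2 hB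
    hf hdeg (by ring) (by simp)
  refine ⟨T, ⟨fun v w => by rw [hT, one_mul], hTf⟩, ?_⟩
  rw [← horb]
  simp only [IsDistinguishedSelfAdjoint, coeffForm_apply, one_pow, one_mul, AlgHom.id_apply]

end

end ArithInv

end

theorem mainTheorem1 {k ks W : Type*} [Field k] [Field ks] [Algebra k ks] [IsSepClosure k ks]
    [AddCommGroup W] [Module k W] [FiniteDimensional k W] (h2 : (2 : k) ≠ 0) (n : ℕ) (hn : 1 ≤ n)
    (B : LinearMap.BilinForm k W) (hB : ArithInv.IsSplitOrthogonal n B) :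
    (∀ (g : k[X]) (hg : g.Monic) (_ : g.natDegree = n) (hsep : (ArithInv.oddPoly g).Separable),
      (∃ T, ArithInv.IsSkewOp B (ArithInv.oddPoly g) T ∧
        {S | ArithInv.IsDistinguishedSkew n hg B S} = ArithInv.orbit B T) ∧
      ∀ (T : Module.End k W) (hT : ArithInv.IsSkewOp B (ArithInv.oddPoly g) T),
        ArithInv.IsDistinguishedSkew n hg B T →
        (∀ S, ArithInv.IsSkewOp B (ArithInv.oddPoly g) S →
          S.baseChange ks ∈ ArithInv.orbit (B.baseChange ks) (T.baseChange ks)) ∧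
        ∃ Φ : {O : Set (Module.End k W) //
              (∃ S, ArithInv.IsSkewOp B (ArithInv.oddPoly g) S ∧ O = ArithInv.orbit B S) ∧
                O ≠ ArithInv.orbit B T} ≃
            {c : (ArithInv.algK g)ˣ ⧸ ArithInv.normSubgroup g //
              ArithInv.gammaSkew ks h2 hB hg hsep hT c = ArithInv.H1.base _ _ ∧ c ≠ 1},
          ∀ O, ∀ S ∈ O.1,
            ArithInv.IsOrbitClass ks B T S (ArithInv.deltaSkew ks h2 hB hg hsep hT (Φ O).1)) ∧
    (∀ (f : k[X]) (hf : f.Monic) (_ : f.natDegree = 2 * n + 1) (hsep : f.Separable),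
      (∃ T, ArithInv.IsSelfAdjointOp B f T ∧
        {S | ArithInv.IsDistinguishedSelfAdjoint n hf B S} = ArithInv.orbit B T) ∧
      ∀ (T : Module.End k W) (hT : ArithInv.IsSelfAdjointOp B f T),
        ArithInv.IsDistinguishedSelfAdjoint n hf B T →
        (∀ S, ArithInv.IsSelfAdjointOp B f S →
          S.baseChange ks ∈ ArithInv.orbit (B.baseChange ks) (T.baseChange ks)) ∧
        ∃ Φ : {O : Set (Module.End k W) //
              (∃ S, ArithInv.IsSelfAdjointOp B f S ∧ O = ArithInv.orbit B S) ∧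
                O ≠ ArithInv.orbit B T} ≃
            {c : ArithInv.normOne f //
              ArithInv.gammaSelfAdjoint ks h2 hB hf hsep hT c = ArithInv.H1.base _ _ ∧ c ≠ 1},
          ∀ O, ∀ S ∈ O.1,
            ArithInv.IsOrbitClass ks B T S
              (ArithInv.deltaSelfAdjoint ks h2 hB hf hsep hT (Φ O).1)) := by
  refine ⟨fun g hg hdeg hsep => ⟨ArithInv.exists_distinguished_skew h2 hB hg hdeg,
    fun T hT _ => ?_⟩, fun f hf hdeg hsep => ⟨ArithInv.exists_distinguished_selfAdjoint h2 hB hf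
    hdeg, fun T hT _ => ArithInv.selfAdjoint_classification h2 hB hf hsep hT⟩⟩
  -- Here `n ≥ 1` enters: for `n = 0` one has `g = 1` and `K` is the zero ring.
  have : Nontrivial (ArithInv.algK g) := AdjoinRoot.nontrivial g (by
    rw [degree_eq_natDegree hg.ne_zero, hdeg]
    exact_mod_cast (by omega : n ≠ 0))
  exact ArithInv.skew_classification h2 hB hg hsep hT
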